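/- Let $\Omega\subset\mathbb R^3$ be an arbitrary open set. **Coefficients.** Let $a_0,a_1>0$ be constants, let $a_{ij}=a_{ji}\in L^\infty(\Omega)$, $1\le i,j\le 3$, satisfy $a_0|\xi|^2\le\sum_{i,j}a_{ij}(x)\xi_i\xi_j\le a_1|\xi|^2$ for a.e. $x\in\Omega$ and all $\xi\in\mathbb R^3$, and put $A(x)=(a_{ij}(x))_{i,j}$. Let $\beta\colon\Omega\to\mathbb R$ be measurable and such that for every $\eta>0$ there is $C_\eta\ge0$ with $\big||\beta|^{1/2}u\big|_{L^2}^2\le\eta|u|_{H^1}^2+C_\eta|u|_{L^2}^2$ for all $u\in H^1_0(\Omega)$, and such that $\inf\{\langle A\nabla u,\nabla u\rangle+\langle\beta u,u\rangle : u\in H^1_0(\Omega),\ |u|_{L^2}=1\}>0$. **Nonlinearity.** Let $f\colon\Omega\times\mathbb R\to\mathbb R$ be such that $f(\cdot,u)$ is measurable for every $u$, $f(\cdot,0)\in L^2(\Omega)$, $f(x,\cdot)\in C^2(\mathbb R)$ for a.e. $x$, $\partial_uf(\cdot,0)\in L^\infty(\Omega)$, and $|\partial_{uu}f(x,u)|\le\overline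 C(1+|u|)$ for all $u$ and a.e. $x$, with a constant $\overline C\ge 0$. Suppose moreover that, with $F(x,u)=\int_0^uf(x,s)\,ds$, there are $\overline\mu>0$ and $c\in L^2(\Omega)$ such that $f(x,u)u-\overline\mu F(x,u)\le c(x)$ and $F(x,u)\le c(x)$ for all $u$ and a.e. $x$. **Spaces.** Let $H_0=L^2(\Omega)$ with its usual scalar product $\langle\cdot,\cdot\rangle$ and norm $|\cdot|$, let $H_1=H^1_0(\Omega)$ with the scalar product $\langle u,v\rangle_{H_1}=\langle A\nabla u,\nabla v\rangle+\langle\beta u,v\rangle$ (whose norm is equivalent to the usual one), and let $H_{-1}$ be the dual of $H_1$ with the dual scalar product $\langle w,w'\rangle_{H_{-1}}=\langle Rw,Rw'\rangle_{H_1}$, where $R\colon H_{-1}\to H_1$ is the Riesz isomorphism, $\langle Rw,\zeta\rangle_{H_1}=w(\zeta)$. A function $h$ on $\Omega$ is regarded as an element of $H_{-1}$ via $\zeta\mapsto\int_\Omega h\zeta\,dx$ whenever this integral exists for all $\zeta\in H_1$ and defines a bounded functional; in particular $H_0\subset H_{-1}$. **Full solutions.** Let $\varepsilon>0$. Let $\mathbf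 B_\varepsilon$ be the operator in $H_1\times H_0$ whose domain consists of the $(u,v)\in H_1\times H_0$ with $v\in H^1_0(\Omega)$ and $\beta u-\sum_{ij}(a_{ij}u_{x_j})_{x_i}\in L^2(\Omega)$ in the sense of distributions, with $$\mathbf B_\varepsilon(u,v)=\Big(-v,\ \tfrac1\varepsilon v+\tfrac1\varepsilon\beta u-\tfrac1\varepsilon\sum_{ij}(a_{ij}u_{x_j})_{x_i}\Big),$$ and let $(e^{-\mathbf B_\varepsilon t})_{t\ge0}$ be the $C_0$-semigroup on $H_1\times H_0$ with infinitesimal generator $-\mathbf B_\varepsilon$. A full solution of $\pi_\varepsilon$, the semiflow generated by the mild solutions of $\varepsilon u_{tt}+u_t+\beta u-\sum_{ij}(a_{ij}u_{x_j})_{x_i}=f(x,u)$ in $\Omega$, $u=0$ on $\partial\Omega$, is a continuous map $z=(u,v)\colon\mathbb R\to H_1\times H_0$ such that for all $t_0\le t$ $$z(t)=e^{-\mathbf B_\varepsilon(t-t_0)}z(t_0)+\int_{t_0}^te^{-\mathbf B_\varepsilon(t-s)}\big(0,\tfrac1\varepsilon f(\cdot,u(s)(\cdot))\big)\,ds .$$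 **Proposition.** Let $z=(u,v)\colon\mathbb R\to H_1\times H_0$ be a full solution of $\pi_\varepsilon$. Then $z$ is differentiable as a map into $H_0\times H_{-1}$, and $v$ is the derivative of $u$ as a map into $H_0$. Let $w\colon\mathbb R\to H_{-1}$ be the derivative of $v$ as a map into $H_{-1}$, and let $g(t)=\partial_uf(\cdot,u(t)(\cdot))\,v(t)$; this belongs to $H_{-1}$ for every $t\in\mathbb R$. Then the function $$\alpha(t)=\tfrac12\langle v(t),v(t)\rangle+\tfrac12\varepsilon\langle w(t),w(t)\rangle_{H_{-1}},\qquad t\in\mathbb R,$$ is differentiable, and for every $t\in\mathbb R$ $$\alpha'(t)=-\langle w(t),w(t)\rangle_{H_{-1}}+\langle g(t),w(t)\rangle_{H_{-1}} .$$ -/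

import Mathlib

open MeasureTheory Filter Topology Set TopologicalSpace InnerProductSpace
open scoped Distributions Gradient ENNReal

namespace DampedWave

noncomputable section

/-! ### Function spaces on an open set `Ω ⊆ ℝ³` -/

/-- Euclidean three-space. -/
abbrev E3 : Type := EuclideanSpace ℝ (Fin 3)

/-- Lebesgue measure on `Ω`. -/
abbrev leb (Ω : Opens E3) : Measure E3 := volume.restrict (Ω : Set E3)

/-- `H_0 = L²(Ω)`. -/
abbrev L2 (Ω : Opens E3) : Type := Lp ℝ 2 (leb Ω)

/-- The Hilbert space `L²(Ω) × L²(Ω; ℝ³)` in which the pairs `(u, ∇u)` live; its norm, restricted to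
such pairs, is the usual norm of `H¹(Ω)`. -/
abbrev GraphSpace (Ω : Opens E3) : Type := WithLp 2 (L2 Ω × Lp E3 2 (leb Ω))

/-- The pairs `(φ, ∇φ)` with `φ ∈ C_c^∞(Ω)`. -/
def testGraph (Ω : Opens E3) : Submodule ℝ (GraphSpace Ω) where
  carrier := {p | ∃ φ : 𝓓(Ω, ℝ), p.fst =ᵐ[leb Ω] φ ∧ p.snd =ᵐ[leb Ω] ∇ φ}
  zero_mem' := by
    refine ⟨0, ?_, ?_⟩
    · simpa using Lp.coeFn_zero ℝ 2 (leb Ω)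
    · have h : (∇ (⇑(0 : 𝓓(Ω, ℝ))) : E3 → E3) = 0 := by
        funext x
        exact gradient_fun_const x (0 : ℝ)
      rw [h]
      exact Lp.coeFn_zero E3 2 (leb Ω)
  add_mem' := by
    rintro p q ⟨φ, h1, h2⟩ ⟨ψ, h3, h4⟩
    refine ⟨φ + ψ, ?_, ?_⟩
    · refine (Lp.coeFn_add p.fst q.fst).trans ?_
      filter_upwards [h1, h3] with x hx hy
      simp [hx, hy]
    · refine (Lp.coeFn_add p.snd q.snd).trans ?_
      filter_upwards [h2, h4] with x hx hy
      have d1 : DifferentiableAt ℝ φ x := (φ.contDiff.differentiable (by simp)) x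
      have d2 : DifferentiableAt ℝ ψ x := (ψ.contDiff.differentiable (by simp)) x
      simp only [Pi.add_apply, hx, hy, gradient]
      rw [FunLike.coe_add, fderiv_add d1 d2, map_add]
  smul_mem' := by
    rintro c p ⟨φ, h1, h2⟩
    refine ⟨c • φ, ?_, ?_⟩
    · refine (Lp.coeFn_smul c p.fst).trans ?_
      filter_upwards [h1] with x hx
      simp [hx]
    · refine (Lp.coeFn_smul c p.snd).trans ?_
      filter_upwards [h2] with x hx
      have d1 : DifferentiableAt ℝ φ x := (φ.contDiff.differentiable (by simp)) x
      simp only [Pi.smul_apply, hx, gradient]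
      rw [FunLike.coe_smul, fderiv_const_smul d1 c, map_smul]

/-- The Sobolev space `H¹₀(Ω)`: the closure of `C_c^∞(Ω)` in the norm of `H¹(Ω)`. A function `u` is
represented by the pair `(u, ∇u)`; the second component is determined by the first one. The inherited
norm is `(|u|²_{L²} + |∇u|²_{L²})^{1/2}`. -/
abbrev H10 (Ω : Opens E3) : Submodule ℝ (GraphSpace Ω) := (testGraph Ω).topologicalClosure

/-- The inclusion `H¹₀(Ω) → L²(Ω)`. -/
def H10.toL2 {Ω : Opens E3} : H10 Ω →L[ℝ] L2 Ω :=
  (WithLp.fstL 2 ℝ (L2 Ω) (Lp E3 2 (leb Ω))).comp (H10 Ω).subtypeL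

/-- The weak gradient of an element of `H¹₀(Ω)`. -/
def H10.grad {Ω : Opens E3} : H10 Ω →L[ℝ] Lp E3 2 (leb Ω) :=
  (WithLp.sndL 2 ℝ (L2 Ω) (Lp E3 2 (leb Ω))).comp (H10 Ω).subtypeL

/-- The form `⟨A∇u, ∇v⟩ + ⟨βu, v⟩` on `H¹₀(Ω)`. -/
def energyForm {Ω : Opens E3} (a : Fin 3 → Fin 3 → E3 → ℝ) (β : E3 → ℝ) (u v : H10 Ω) : ℝ :=
  (∫ x in (Ω : Set E3), ∑ i, ∑ j, a i j x * H10.grad u x j * H10.grad v x i)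
    + ∫ x in (Ω : Set E3), β x * H10.toL2 u x * H10.toL2 v x

/-- The coefficients of the operator `u ↦ βu - ∑_{ij} (a_{ij} u_{x_j})_{x_i}` and the standing
assumptions on them. Only the values on `Ω` matter. -/
structure Coefficients (Ω : Opens E3) where
  a₀ : ℝ
  a₁ : ℝ
  a : Fin 3 → Fin 3 → E3 → ℝ
  β : E3 → ℝ
  a₀_pos : 0 < a₀
  a₁_pos : 0 < a₁
  a_memLp : ∀ i j, MemLp (a i j) ∞ (leb Ω)
  a_symm : ∀ i j, a i j =ᵐ[leb Ω] a j i
  elliptic : ∀ᵐ x ∂(leb Ω), ∀ ξ : E3,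
    a₀ * ‖ξ‖ ^ 2 ≤ ∑ i, ∑ j, a i j x * ξ i * ξ j ∧ ∑ i, ∑ j, a i j x * ξ i * ξ j ≤ a₁ * ‖ξ‖ ^ 2
  β_meas : AEMeasurable β (leb Ω)
  /-- `||β|^{1/2} u|²_{L²} ≤ η |u|²_{H¹} + C_η |u|²_{L²}` -/
  β_bound : ∀ η : ℝ, 0 < η → ∃ C : ℝ, 0 ≤ C ∧ ∀ u : H10 Ω,
    eLpNorm (fun x => √|β x| * H10.toL2 u x) 2 (leb Ω) ^ 2
      ≤ ENNReal.ofReal (η * ‖u‖ ^ 2 + C * ‖H10.toL2 u‖ ^ 2)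
  /-- `λ₁ = inf {⟨A∇u, ∇u⟩ + ⟨βu, u⟩ | |u|_{L²} = 1} > 0`, the infimum being taken in `[-∞, ∞]`. -/
  lam_pos : 0 < ⨅ (u : H10 Ω) (_ : ‖H10.toL2 u‖ = 1), (energyForm a β u u : EReal)

variable {Ω : Opens E3}

namespace Coefficients

variable (P : Coefficients Ω)

lemma memLp_sqrt_β (u : H10 Ω) : MemLp (fun x => √|P.β x| * H10.toL2 u x) 2 (leb Ω) := by
  refine ⟨?_, ?_⟩
  · have h1 : AEMeasurable (fun x => √|P.β x|) (leb Ω) :=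
      (continuous_abs.measurable.comp_aemeasurable P.β_meas).sqrt
    exact (h1.aestronglyMeasurable).mul (Lp.aestronglyMeasurable _)
  · obtain ⟨C, -, hC⟩ := P.β_bound 1 one_pos
    have h := (hC u).trans_lt ENNReal.ofReal_lt_top
    by_contra hcon
    rw [not_lt, top_le_iff] at hcon
    rw [hcon] at h
    simp at h

lemma integrable_β (u v : H10 Ω) :
    Integrable (fun x => P.β x * H10.toL2 u x * H10.toL2 v x) (leb Ω) := by
  have h := (P.memLp_sqrt_β u).integrable_mul (P.memLp_sqrt_β v)
  refine h.mono ?_ (Eventually.of_forall fun x => ?_)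
  · exact (P.β_meas.aestronglyMeasurable.mul (Lp.aestronglyMeasurable _)).mul
      (Lp.aestronglyMeasurable _)
  · have hs : √|P.β x| * √|P.β x| = |P.β x| := Real.mul_self_sqrt (abs_nonneg _)
    have e : |(√|P.β x| * H10.toL2 u x) * (√|P.β x| * H10.toL2 v x)|
        = |P.β x * H10.toL2 u x * H10.toL2 v x| := by
      rw [show (√|P.β x| * H10.toL2 u x) * (√|P.β x| * H10.toL2 v x)
        = (√|P.β x| * √|P.β x|) * (H10.toL2 u x * H10.toL2 v x) by ring, hs, mul_assoc (P.β x)]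
      simp only [abs_mul, abs_abs]
    simp only [Pi.mul_apply, Real.norm_eq_abs]
    exact e.ge

lemma memLp_grad (u : H10 Ω) (i : Fin 3) : MemLp (fun x => H10.grad u x i) 2 (leb Ω) := by
  let p : E3 →L[ℝ] ℝ := EuclideanSpace.proj i
  exact p.comp_memLp' (Lp.memLp (H10.grad u))

lemma integrable_a (u v : H10 Ω) : Integrable
    (fun x => ∑ i, ∑ j, P.a i j x * H10.grad u x j * H10.grad v x i) (leb Ω) := by
  refine integrable_finsetSum _ fun i _ => integrable_finsetSum _ fun j _ => ?_
  have h1 : MemLp (fun x => P.a i j x * H10.grad u x j) 2 (leb Ω) :=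
    (memLp_grad u j).mul (P.a_memLp i j)
  exact h1.integrable_mul (memLp_grad v i)

lemma abs_integral_β_le {η C : ℝ} (hη : 0 ≤ η) (hC0 : 0 ≤ C) (hC : ∀ u : H10 Ω,
    eLpNorm (fun x => √|P.β x| * H10.toL2 u x) 2 (leb Ω) ^ 2
      ≤ ENNReal.ofReal (η * ‖u‖ ^ 2 + C * ‖H10.toL2 u‖ ^ 2)) (u : H10 Ω) :
    |∫ x in (Ω : Set E3), P.β x * H10.toL2 u x * H10.toL2 u x|
      ≤ η * ‖u‖ ^ 2 + C * ‖H10.toL2 u‖ ^ 2 := by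
  have h0 : 0 ≤ η * ‖u‖ ^ 2 + C * ‖H10.toL2 u‖ ^ 2 := by positivity
  have h1 := ENNReal.toReal_mono ENNReal.ofReal_ne_top (hC u)
  rw [ENNReal.toReal_ofReal h0, ENNReal.toReal_pow] at h1
  refine le_trans ?_ h1
  have h2 := (P.memLp_sqrt_β u).eLpNorm_eq_integral_rpow_norm (by simp) (by simp)
  have h3 : ∫ x in (Ω : Set E3), ‖√|P.β x| * H10.toL2 u x‖ ^ (2 : ℝ)
      = ∫ x in (Ω : Set E3), |P.β x * H10.toL2 u x * H10.toL2 u x| := by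
    refine integral_congr_ae (Eventually.of_forall fun x => ?_)
    have hs : √|P.β x| ^ 2 = |P.β x| := Real.sq_sqrt (abs_nonneg _)
    simp only [Real.norm_eq_abs, Real.rpow_two, sq_abs, mul_pow, hs, abs_mul]
    rw [mul_assoc, ← sq, sq_abs]
  have hI : 0 ≤ ∫ x in (Ω : Set E3), |P.β x * H10.toL2 u x * H10.toL2 u x| :=
    integral_nonneg fun x => abs_nonneg _
  have h4 : (eLpNorm (fun x => √|P.β x| * H10.toL2 u x) 2 (leb Ω)).toReal ^ 2
      = ∫ x in (Ω : Set E3), |P.β x * H10.toL2 u x * H10.toL2 u x| := by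
    rw [h2]
    simp only [ENNReal.toReal_ofNat]
    rw [h3, ENNReal.toReal_ofReal (by positivity), ← Real.rpow_two, ← Real.rpow_mul hI]
    norm_num
  rw [h4]
  exact abs_integral_le_integral_abs

lemma norm_sq_eq (u : H10 Ω) : ‖u‖ ^ 2 = ‖H10.toL2 u‖ ^ 2 + ‖H10.grad u‖ ^ 2 := by
  have h := WithLp.prod_norm_sq_eq_of_L2 (u : GraphSpace Ω)
  exact h

lemma norm_grad_sq (u : H10 Ω) : ‖H10.grad u‖ ^ 2 = ∫ x in (Ω : Set E3), ‖H10.grad u x‖ ^ 2 := by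
  rw [← real_inner_self_eq_norm_sq, L2.inner_def]
  simp

lemma le_integral_a (u : H10 Ω) : P.a₀ * ‖H10.grad u‖ ^ 2
    ≤ ∫ x in (Ω : Set E3), ∑ i, ∑ j, P.a i j x * H10.grad u x j * H10.grad u x i := by
  rw [norm_grad_sq, ← integral_const_mul]
  refine integral_mono_ae ?_ (P.integrable_a u u) ?_
  · exact ((Lp.memLp (H10.grad u)).integrable_norm_pow (by simp)).const_mul _
  · filter_upwards [P.elliptic] with x hx
    refine (hx (H10.grad u x)).1.trans_eq ?_
    exact Finset.sum_congr rfl fun i _ => Finset.sum_congr rfl fun j _ => by ring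

lemma integral_a_le (u : H10 Ω) :
    ∫ x in (Ω : Set E3), ∑ i, ∑ j, P.a i j x * H10.grad u x j * H10.grad u x i
      ≤ P.a₁ * ‖H10.grad u‖ ^ 2 := by
  rw [norm_grad_sq, ← integral_const_mul]
  refine integral_mono_ae (P.integrable_a u u) ?_ ?_
  · exact ((Lp.memLp (H10.grad u)).integrable_norm_pow (by simp)).const_mul _
  · filter_upwards [P.elliptic] with x hx
    refine le_trans (le_of_eq ?_) (hx (H10.grad u x)).2
    exact Finset.sum_congr rfl fun i _ => Finset.sum_congr rfl fun j _ => by ring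

lemma energyForm_add_left (u v w : H10 Ω) : energyForm P.a P.β (u + v) w
    = energyForm P.a P.β u w + energyForm P.a P.β v w := by
  have h1 : (H10.toL2 (u + v) : E3 → ℝ) =ᵐ[leb Ω] H10.toL2 u + H10.toL2 v := by
    rw [map_add]; exact Lp.coeFn_add _ _
  have h2 : (H10.grad (u + v) : E3 → E3) =ᵐ[leb Ω] H10.grad u + H10.grad v := by
    rw [map_add]; exact Lp.coeFn_add _ _
  unfold energyForm
  rw [add_add_add_comm, ← integral_add (P.integrable_a u w) (P.integrable_a v w),
    ← integral_add (P.integrable_β u w) (P.integrable_β v w)]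
  congr 1
  · refine integral_congr_ae ?_
    filter_upwards [h2] with x hx
    simp only [hx, Pi.add_apply, PiLp.add_apply, ← Finset.sum_add_distrib]
    exact Finset.sum_congr rfl fun i _ => Finset.sum_congr rfl fun j _ => by ring
  · refine integral_congr_ae ?_
    filter_upwards [h1] with x hx
    simp only [hx, Pi.add_apply]
    ring

lemma energyForm_smul_left (c : ℝ) (u w : H10 Ω) : energyForm P.a P.β (c • u) w
    = c * energyForm P.a P.β u w := by
  have h1 : (H10.toL2 (c • u) : E3 → ℝ) =ᵐ[leb Ω] c • H10.toL2 u := by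
    rw [map_smul]; exact Lp.coeFn_smul _ _
  have h2 : (H10.grad (c • u) : E3 → E3) =ᵐ[leb Ω] c • H10.grad u := by
    rw [map_smul]; exact Lp.coeFn_smul _ _
  unfold energyForm
  rw [mul_add, ← integral_const_mul, ← integral_const_mul]
  congr 1
  · refine integral_congr_ae ?_
    filter_upwards [h2] with x hx
    simp only [hx, Pi.smul_apply, PiLp.smul_apply, smul_eq_mul, Finset.mul_sum]
    exact Finset.sum_congr rfl fun i _ => Finset.sum_congr rfl fun j _ => by ring
  · refine integral_congr_ae ?_
    filter_upwards [h1] with x hx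
    simp only [hx, Pi.smul_apply, smul_eq_mul]
    ring

lemma energyForm_symm (u v : H10 Ω) : energyForm P.a P.β u v = energyForm P.a P.β v u := by
  unfold energyForm
  congr 1
  · refine integral_congr_ae ?_
    have h : ∀ᵐ x ∂(leb Ω), ∀ i j, P.a i j x = P.a j i x := by
      simp only [ae_all_iff]
      exact P.a_symm
    filter_upwards [h] with x hx
    rw [Finset.sum_comm]
    exact Finset.sum_congr rfl fun i _ => Finset.sum_congr rfl fun j _ => by rw [hx j i]; ring
  · refine integral_congr_ae (Eventually.of_forall fun x => ?_)
    simp only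
    ring

lemma exists_lam : ∃ l : ℝ, 0 < l ∧ ∀ u : H10 Ω,
    l * ‖H10.toL2 u‖ ^ 2 ≤ energyForm P.a P.β u u := by
  obtain ⟨l, hl0, hl⟩ := EReal.lt_iff_exists_real_btwn.1 P.lam_pos
  have hl0 : 0 < l := by exact_mod_cast hl0
  have hunit : ∀ u : H10 Ω, ‖H10.toL2 u‖ = 1 → l ≤ energyForm P.a P.β u u := by
    intro u hu
    exact_mod_cast hl.le.trans (iInf₂_le u hu)
  obtain ⟨C, hC0, hC⟩ := P.β_bound P.a₀ P.a₀_pos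
  refine ⟨l, hl0, fun u => ?_⟩
  by_cases hu : ‖H10.toL2 u‖ = 0
  · have h1 := P.abs_integral_β_le P.a₀_pos.le hC0 hC u
    have h2 := P.le_integral_a u
    have h3 := norm_sq_eq u
    rw [hu] at h1 h3 ⊢
    have h4 := neg_abs_le (∫ x in (Ω : Set E3), P.β x * H10.toL2 u x * H10.toL2 u x)
    unfold energyForm
    rw [h3] at h1
    simp only [ne_eq, OfNat.ofNat_ne_zero, not_false_eq_true, zero_pow, zero_add, mul_zero,
      add_zero] at h1 ⊢
    linarith
  · have h1 := hunit (‖H10.toL2 u‖⁻¹ • u) (by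
      rw [map_smul, norm_smul, norm_inv, norm_norm, inv_mul_cancel₀ hu])
    rw [P.energyForm_smul_left, P.energyForm_symm, P.energyForm_smul_left] at h1
    have h2 : 0 < ‖H10.toL2 u‖ ^ 2 := by positivity
    have h3 := mul_le_mul_of_nonneg_right h1 h2.le
    refine h3.trans_eq ?_
    field_simp

lemma exists_lower : ∃ c : ℝ, 0 < c ∧ ∀ u : H10 Ω, c * ‖u‖ ^ 2 ≤ energyForm P.a P.β u u := by
  obtain ⟨l, hl0, hl⟩ := P.exists_lam
  have ha := P.a₀_pos
  obtain ⟨C, hC0, hC⟩ := P.β_bound (P.a₀ / 2) (by positivity)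
  set K : ℝ := P.a₀ / 2 + C with hK
  have hKpos : 0 < K := by positivity
  have key : ∀ u : H10 Ω, P.a₀ / 2 * ‖H10.grad u‖ ^ 2
      ≤ energyForm P.a P.β u u + K * ‖H10.toL2 u‖ ^ 2 := by
    intro u
    have h1 := P.abs_integral_β_le (by positivity) hC0 hC u
    have h2 := P.le_integral_a u
    have h3 := norm_sq_eq u
    have h4 := neg_abs_le (∫ x in (Ω : Set E3), P.β x * H10.toL2 u x * H10.toL2 u x)
    unfold energyForm
    rw [h3] at h1
    rw [hK]
    nlinarith
  have hD : 0 < 1 / l + 2 / P.a₀ * (1 + K / l) := by positivity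
  refine ⟨(1 / l + 2 / P.a₀ * (1 + K / l))⁻¹, by positivity, fun u => ?_⟩
  rw [inv_mul_le_iff₀ hD, norm_sq_eq]
  have h1 : ‖H10.toL2 u‖ ^ 2 ≤ 1 / l * energyForm P.a P.β u u := by
    rw [one_div, le_inv_mul_iff₀ hl0]; exact hl u
  have h2 : ‖H10.grad u‖ ^ 2 ≤ 2 / P.a₀ * (energyForm P.a P.β u u + K * ‖H10.toL2 u‖ ^ 2) := by
    have h := mul_le_mul_of_nonneg_left (key u) (show 0 ≤ 2 / P.a₀ by positivity)
    refine le_trans (le_of_eq ?_) h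
    field_simp
  have h3 : 2 / P.a₀ * (energyForm P.a P.β u u + K * ‖H10.toL2 u‖ ^ 2)
      ≤ 2 / P.a₀ * (energyForm P.a P.β u u + K * (1 / l * energyForm P.a P.β u u)) := by
    gcongr
  have h4 : (1 / l + 2 / P.a₀ * (1 + K / l)) * energyForm P.a P.β u u
      = 1 / l * energyForm P.a P.β u u
        + 2 / P.a₀ * (energyForm P.a P.β u u + K * (1 / l * energyForm P.a P.β u u)) := by
    ring
  linarith

lemma exists_upper : ∃ c : ℝ, 0 < c ∧ ∀ u : H10 Ω, energyForm P.a P.β u u ≤ c * ‖u‖ ^ 2 := by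
  obtain ⟨C, hC0, hC⟩ := P.β_bound 1 one_pos
  have ha := P.a₁_pos
  refine ⟨P.a₁ + 1 + C, by positivity, fun u => ?_⟩
  have h1 := P.abs_integral_β_le zero_le_one hC0 hC u
  have h2 := P.integral_a_le u
  have h3 := norm_sq_eq u
  have h4 := le_abs_self (∫ x in (Ω : Set E3), P.β x * H10.toL2 u x * H10.toL2 u x)
  have h5 : P.a₁ * ‖H10.grad u‖ ^ 2 ≤ P.a₁ * ‖u‖ ^ 2 :=
    mul_le_mul_of_nonneg_left (by rw [h3]; linarith [sq_nonneg ‖H10.toL2 u‖]) ha.le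
  have h6 : C * ‖H10.toL2 u‖ ^ 2 ≤ C * ‖u‖ ^ 2 :=
    mul_le_mul_of_nonneg_left (by rw [h3]; linarith [sq_nonneg ‖H10.grad u‖]) hC0
  unfold energyForm
  linarith

end Coefficients

/-! ### The spaces `H_1` and `H_{-1}` -/

/-- `H_1`: the space `H¹₀(Ω)` with the scalar product `⟨A∇u, ∇v⟩ + ⟨βu, v⟩`. -/
def H1 (_P : Coefficients Ω) : Type := H10 Ω

namespace H1

variable (P : Coefficients Ω)

instance : AddCommGroup (H1 P) := inferInstanceAs (AddCommGroup (H10 Ω))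

instance : Module ℝ (H1 P) := inferInstanceAs (Module ℝ (H10 Ω))

/-- The identity map `H_1 → H¹₀(Ω)`. -/
def toH10ₗ : H1 P ≃ₗ[ℝ] H10 Ω := LinearEquiv.refl ℝ (H10 Ω)

instance core : InnerProductSpace.Core ℝ (H1 P) where
  inner u v := energyForm P.a P.β (toH10ₗ P u) (toH10ₗ P v)
  conj_inner_symm u v := P.energyForm_symm _ _
  re_inner_nonneg u := by
    obtain ⟨c, hc, h⟩ := P.exists_lower
    exact (by positivity : 0 ≤ c * ‖toH10ₗ P u‖ ^ 2).trans (h _)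
  add_left u v w := P.energyForm_add_left _ _ _
  smul_left u v c := P.energyForm_smul_left c _ _
  definite u hu := by
    obtain ⟨c, hc, h⟩ := P.exists_lower
    have h1 : c * ‖toH10ₗ P u‖ ^ 2 ≤ 0 := (h (toH10ₗ P u)).trans_eq hu
    have h2 : ‖toH10ₗ P u‖ ^ 2 ≤ 0 := by
      by_contra hcon
      push Not at hcon
      exact absurd h1 (not_le.2 (mul_pos hc hcon))
    have h3 : ‖toH10ₗ P u‖ = 0 := by
      have := sq_nonneg ‖toH10ₗ P u‖
      exact pow_eq_zero_iff (two_ne_zero) |>.1 (le_antisymm h2 this)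
    exact (toH10ₗ P).map_eq_zero_iff.1 (norm_eq_zero.1 h3)

instance : NormedAddCommGroup (H1 P) := (core P).toNormedAddCommGroup

instance : InnerProductSpace ℝ (H1 P) := InnerProductSpace.ofCore (core P).toCore

lemma inner_def (u v : H1 P) : ⟪u, v⟫_ℝ = energyForm P.a P.β (toH10ₗ P u) (toH10ₗ P v) := rfl

lemma norm_sq (u : H1 P) : ‖u‖ ^ 2 = energyForm P.a P.β (toH10ₗ P u) (toH10ₗ P u) := by
  rw [← real_inner_self_eq_norm_sq, inner_def]

/-- The identity map `H_1 → H¹₀(Ω)` is a linear homeomorphism: the two norms are equivalent. -/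
def toH10 : H1 P ≃L[ℝ] H10 Ω where
  toLinearEquiv := toH10ₗ P
  continuous_toFun := by
    obtain ⟨c, hc, h⟩ := P.exists_lower
    refine AddMonoidHomClass.continuous_of_bound (toH10ₗ P).toLinearMap (√c⁻¹) fun u => ?_
    refine le_of_sq_le_sq ?_ (by positivity)
    rw [mul_pow, Real.sq_sqrt (by positivity), norm_sq, ← div_eq_inv_mul, le_div_iff₀' hc]
    exact h _
  continuous_invFun := by
    obtain ⟨c, hc, h⟩ := P.exists_upper
    refine AddMonoidHomClass.continuous_of_bound (toH10ₗ P).symm.toLinearMap (√c) fun u => ?_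
    refine le_of_sq_le_sq ?_ (by positivity)
    rw [mul_pow, Real.sq_sqrt hc.le, norm_sq]
    exact h _

instance : CompleteSpace (H1 P) :=
  have : CompleteSpace (H10 Ω) :=
    (testGraph Ω).isClosed_topologicalClosure.completeSpace_coe
  (completeSpace_congr (e := (toH10 P).toEquiv) (toH10 P).isUniformEmbedding).2 this

variable {P}

/-- The inclusion `H_1 → H_0`. -/
def toL2 : H1 P →L[ℝ] L2 Ω := H10.toL2.comp (toH10 P).toContinuousLinearMap

/-- The weak gradient of an element of `H_1`. -/
def grad : H1 P →L[ℝ] Lp E3 2 (leb Ω) := H10.grad.comp (toH10 P).toContinuousLinearMap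

end H1

/-- `H_{-1}`: the dual space of `H_1`. Its norm is the dual norm of the norm of `H_1`. -/
abbrev Hneg1 (P : Coefficients Ω) : Type := StrongDual ℝ (H1 P)

namespace Hneg1

variable (P : Coefficients Ω)

/-- The scalar product of `H_{-1}`: `⟨w, w'⟩_{H_{-1}} = ⟨R w, R w'⟩_{H_1}`, where
`R : H_{-1} → H_1` is the Riesz isomorphism, that is, `⟨R w, ζ⟩_{H_1} = w(ζ)`. -/
def sp (w w' : Hneg1 P) : ℝ := ⟪(toDual ℝ (H1 P)).symm w, (toDual ℝ (H1 P)).symm w'⟫_ℝ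

/-- The inclusion `H_0 → H_{-1}`, `v ↦ (ζ ↦ ⟨v, ζ⟩_{L²})`. -/
def ofL2 : L2 Ω →L[ℝ] Hneg1 P :=
  (ContinuousLinearMap.compL ℝ (H1 P) (L2 Ω) ℝ).flip H1.toL2 ∘L innerSL ℝ

end Hneg1

/-! ### The damped wave equation `ε u_tt + u_t + βu - ∑ (a_{ij} u_{x_j})_{x_i} = f(x, u)` -/

/-- The standing assumptions on the nonlinearity `f : Ω × ℝ → ℝ`. -/
structure IsNonlinearity (Ω : Opens E3) (f : E3 → ℝ → ℝ) : Prop where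
  meas : ∀ u : ℝ, AEMeasurable (fun x => f x u) (leb Ω)
  memLp_zero : MemLp (fun x => f x 0) 2 (leb Ω)
  contDiff : ∀ᵐ x ∂(leb Ω), ContDiff ℝ 2 (f x)
  memLp_deriv_zero : MemLp (fun x => deriv (f x) 0) ∞ (leb Ω)
  growth : ∃ C : ℝ, 0 ≤ C ∧ ∀ᵐ x ∂(leb Ω), ∀ u : ℝ, |iteratedDeriv 2 (f x) u| ≤ C * (1 + |u|)
  dissipative : ∃ m : ℝ, 0 < m ∧ ∃ c : E3 → ℝ, MemLp c 2 (leb Ω) ∧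
    ∀ᵐ x ∂(leb Ω), ∀ u : ℝ,
      f x u * u - m * (∫ s in (0 : ℝ)..u, f x s) ≤ c x ∧ (∫ s in (0 : ℝ)..u, f x s) ≤ c x

open Classical in
/-- The Nemitski operator `u ↦ f(·, u(·))`, as a map into `L²(Ω)`. -/
def nemitski (f : E3 → ℝ → ℝ) (u : L2 Ω) : L2 Ω :=
  if h : MemLp (fun x => f x (u x)) 2 (leb Ω) then h.toLp else 0

/-- `βu - ∑_{ij} (a_{ij} u_{x_j})_{x_i} = h` in the sense of distributions on `Ω`. -/
def IsEllipticImage (P : Coefficients Ω) (u : H1 P) (h : L2 Ω) : Prop :=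
  ∀ φ : 𝓓(Ω, ℝ),
    (∫ x in (Ω : Set E3), ∑ i, ∑ j, P.a i j x * H1.grad u x j * (∇ φ x) i)
      + ∫ x in (Ω : Set E3), P.β x * H1.toL2 u x * φ x
    = ∫ x in (Ω : Set E3), h x * φ x

/-- The graph of the operator `B_ε` in `H_1 × H_0`: its domain consists of the `(u, v)` with
`v ∈ H¹₀(Ω)` and `βu - ∑_{ij} (a_{ij} u_{x_j})_{x_i} ∈ L²(Ω)`, and
`B_ε (u, v) = (-v, (1/ε) v + (1/ε) (βu - ∑_{ij} (a_{ij} u_{x_j})_{x_i}))`. -/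
def IsWaveImage (P : Coefficients Ω) (ε : ℝ) (z y : H1 P × L2 Ω) : Prop :=
  H1.toL2 y.1 = -z.2 ∧ ∃ h : L2 Ω, IsEllipticImage P z.1 h ∧ y.2 = ε⁻¹ • z.2 + ε⁻¹ • h

/-- `T` is a strongly continuous semigroup; only its values at `t ≥ 0` matter. -/
structure IsC0Semigroup {Z : Type*} [NormedAddCommGroup Z] [NormedSpace ℝ Z]
    (T : ℝ → Z →L[ℝ] Z) : Prop where
  zero : T 0 = ContinuousLinearMap.id ℝ Z
  add : ∀ s t : ℝ, 0 ≤ s → 0 ≤ t → T (s + t) = (T s).comp (T t)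
  continuousOn : ∀ z : Z, ContinuousOn (fun t => T t z) (Ici 0)

/-- `T t = e^{-B_ε t}`: the operators `T t` form the strongly continuous semigroup on `H_1 × H_0`
whose infinitesimal generator is exactly `-B_ε`. -/
structure IsWaveSemigroup (P : Coefficients Ω) (ε : ℝ)
    (T : ℝ → (H1 P × L2 Ω) →L[ℝ] (H1 P × L2 Ω)) : Prop extends IsC0Semigroup T where
  generator : ∀ z y : H1 P × L2 Ω,
    IsWaveImage P ε z y ↔ Tendsto (fun t : ℝ => t⁻¹ • (T t z - z)) (𝓝[>] 0) (𝓝 (-y))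

/-- `z : ℝ → H_1 × H_0` is a full solution of the semiflow `π_ε` generated by the mild solutions: `z` is
continuous and satisfies the variation-of-constants formula
`z(t) = e^{-B_ε (t - t₀)} z(t₀) + ∫_{t₀}^t e^{-B_ε (t - s)} (0, (1/ε) f(·, z₁(s))) ds`, `t₀ ≤ t`. -/
def IsFullSolution (P : Coefficients Ω) (f : E3 → ℝ → ℝ) (ε : ℝ) (z : ℝ → H1 P × L2 Ω) : Prop :=
  Continuous z ∧ ∃ T : ℝ → (H1 P × L2 Ω) →L[ℝ] (H1 P × L2 Ω), IsWaveSemigroup P ε T ∧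
    ∀ t₀ t : ℝ, t₀ ≤ t →
      z t = T (t - t₀) (z t₀)
        + ∫ s in t₀..t, T (t - s) (0, ε⁻¹ • nemitski f (H1.toL2 (z s).1))

/-- `V_ε(v, w) = ½ ⟨v, v⟩ + ½ ε ⟨w, w⟩_{H_{-1}}` on `H_0 × H_{-1}`. -/
def V (P : Coefficients Ω) (ε : ℝ) (v : L2 Ω) (w : Hneg1 P) : ℝ :=
  1 / 2 * ⟪v, v⟫_ℝ + 1 / 2 * ε * Hneg1.sp P w w

end

end DampedWave

open DampedWave

/-!
Let `J` be the inclusion `H_1 × H_0 → H_0 × H_{-1}`. The operator `-B_ε` extends to a bounded operator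
`G` from `H_1 × H_0` to `H_0 × H_{-1}`, because the distribution `βu - ∑ (a_{ij} u_{x_j})_{x_i}` is the
Riesz functional `⟨u, ·⟩_{H_1}` (`IsEllipticImage.innerSL_eq`; test functions are dense in `H_1`). Since
`∫_0^h T(s) x ds` always lies in the domain of the generator, `J ∘ z` has the continuous right
derivative `G z + J (0, f(·, u)/ε)`, and a continuous function with a continuous right derivative is
`C¹` (`IsC0Semigroup.hasDerivAt_mild`). This gives `u' = v` in `H_0` and
`v' = w = (f(·, u) - v - ⟨u, ·⟩_{H_1}) / ε` in `H_{-1}`.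

By the Sobolev embedding `H_1 ⊆ L⁶` (`H1.exists_eLpNorm_six_le`), products of up to three elements of
`H_1` are square integrable (`H1.exists_l2Bound`). With the cubic growth of `f` this shows that
`u ↦ f(·, u)` is continuous from `H_1` to `H_0`, that multiplication by `∂_u f(·, u)` is a bounded
operator `H_1 → H_0` depending continuously on `u`, and that the Taylor remainder of `f(·, u)` in
`H_{-1}` is at most `K (1 + |u₁|_{H_1} + |u₂|_{H_1}) |u₁ - u₂|_{H_1} |u₁ - u₂|_{L²}`. As `u` is continuous
into `H_1` and differentiable into `H_0`, the curve `f(·, u(t))` is `C¹` into `H_{-1}`, with derivative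
`g` (`IsNonlinearity.hasDerivAt_nemitski`).

Formally the energy identity for `α` results from pairing the equation `ε w' + w + 𝒜 v = g`, differentiated
in time, with `w` in `H_{-1}`; but `v` is not `H_1`-valued, so `𝒜 v` is not in `H_{-1}`. The difference
quotients of `z` do have values in `H_1 × H_0` and satisfy the identity classically
(`hasDerivAt_energy`). They are jointly continuous in time and step size down to step size zero, so the
integrated identity passes to the limit (`hasDerivAt_of_differenceQuotient`).
-/

namespace DampedWave

/-! ### Strongly continuous semigroups and mild solutions -/

/-- A continuous function with a continuous right derivative is differentiable. -/
lemma hasDerivAt_of_right_deriv {Y : Type*} [NormedAddCommGroup Y] [NormedSpace ℝ Y]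
    [CompleteSpace Y] {y d : ℝ → Y} (hy : Continuous y) (hd : Continuous d)
    (h : ∀ t, HasDerivWithinAt y (d t) (Ici t) t) (t : ℝ) : HasDerivAt y (d t) t := by
  have hI : ∀ s, HasDerivAt (fun s => ∫ τ in (t - 1)..s, d τ) (d s) s := fun s =>
    intervalIntegral.integral_hasDerivAt_right (hd.intervalIntegrable _ _)
      (hd.stronglyMeasurableAtFilter _ _) hd.continuousAt
  have hc : Continuous fun s => ∫ τ in (t - 1)..s, d τ :=
    continuous_iff_continuousAt.2 fun s => (hI s).continuousAt
  have hconst := constant_of_has_deriv_right_zero (a := t - 1) (b := t + 1)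
    (f := fun s => y s - ∫ τ in (t - 1)..s, d τ) (hy.sub hc).continuousOn
    (fun s _ => by rw [← sub_self (d s)]; exact (h s).sub (hI s).hasDerivWithinAt)
  have hloc : y =ᶠ[𝓝 t] fun s => (∫ τ in (t - 1)..s, d τ) + y (t - 1) := by
    filter_upwards [Icc_mem_nhds (show t - 1 < t by linarith) (show t < t + 1 by linarith)]
      with s hs
    have h1 := hconst s hs
    simp only [intervalIntegral.integral_same, sub_zero] at h1
    rw [← h1]
    abel
  exact ((hI t).add_const _).congr_of_eventuallyEq hloc

namespace IsC0Semigroup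

variable {Z : Type*} [NormedAddCommGroup Z] [NormedSpace ℝ Z]
  {T : ℝ → Z →L[ℝ] Z}

lemma intervalIntegrable (hT : IsC0Semigroup T) (x : Z) {a b : ℝ} (ha : 0 ≤ a) (hb : 0 ≤ b) :
    IntervalIntegrable (fun s => T s x) volume a b :=
  ((hT.continuousOn x).mono fun _ hs => (le_min ha hb).trans hs.1).intervalIntegrable

variable [CompleteSpace Z]

lemma exists_bound (hT : IsC0Semigroup T) (K : ℝ) :
    ∃ M, 0 ≤ M ∧ ∀ t ∈ Icc 0 K, ‖T t‖ ≤ M := by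
  obtain ⟨C, hC⟩ := banach_steinhaus (g := fun t : Icc (0 : ℝ) K => T t) (fun x => by
    have h1 : ContinuousOn (fun t => ‖T t x‖) (Icc 0 K) :=
      ((hT.continuousOn x).mono Icc_subset_Ici_self).norm
    obtain ⟨C, hC⟩ := (isCompact_Icc.image_of_continuousOn h1).bddAbove
    exact ⟨C, fun i => hC ⟨i, i.2, rfl⟩⟩)
  exact ⟨max C 0, le_max_right _ _, fun t ht => (hC ⟨t, ht⟩).trans (le_max_left _ _)⟩

lemma continuousOn_uncurry (hT : IsC0Semigroup T) :
    ContinuousOn (fun p : ℝ × Z => T p.1 p.2) (Ici 0 ×ˢ univ) := by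
  rintro ⟨t, x⟩ ⟨ht, -⟩
  obtain ⟨M, hM0, hM⟩ := hT.exists_bound (t + 1)
  have hlim : Tendsto (fun p : ℝ × Z => M * ‖p.2 - x‖ + ‖T p.1 x - T t x‖)
      (𝓝[Ici 0 ×ˢ univ] (t, x)) (𝓝 0) := by
    have h1 : Tendsto (fun p : ℝ × Z => M * ‖p.2 - x‖) (𝓝[Ici 0 ×ˢ univ] (t, x)) (𝓝 0) := by
      have : Continuous fun p : ℝ × Z => M * ‖p.2 - x‖ := by fun_prop
      simpa using (this.tendsto (t, x)).mono_left nhdsWithin_le_nhds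
    have h2 : Tendsto (fun p : ℝ × Z => ‖T p.1 x - T t x‖) (𝓝[Ici 0 ×ˢ univ] (t, x)) (𝓝 0) := by
      have h3 : Tendsto (fun s => ‖T s x - T t x‖) (𝓝[Ici 0] t) (𝓝 0) := by
        simpa using (Tendsto.sub_const ((hT.continuousOn x) t ht) (T t x)).norm
      refine h3.comp (tendsto_nhdsWithin_iff.2 ⟨?_, ?_⟩)
      · exact (continuous_fst.tendsto (t, x)).mono_left nhdsWithin_le_nhds
      · filter_upwards [self_mem_nhdsWithin] with p hp using hp.1
    simpa using h1.add h2
  refine tendsto_iff_norm_sub_tendsto_zero.2 (squeeze_zero' (Eventually.of_forall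
    fun _ => norm_nonneg _) ?_ hlim)
  have hlt : ∀ᶠ p : ℝ × Z in 𝓝[Ici 0 ×ˢ univ] (t, x), p.1 < t + 1 :=
    ((continuous_fst.tendsto (t, x)).mono_left nhdsWithin_le_nhds).eventually_lt_const
      (show t < t + 1 by linarith)
  filter_upwards [self_mem_nhdsWithin, hlt] with p hp hp1
  calc ‖T p.1 p.2 - T t x‖ = ‖T p.1 (p.2 - x) + (T p.1 x - T t x)‖ := by
        rw [map_sub]; abel_nf
    _ ≤ ‖T p.1‖ * ‖p.2 - x‖ + ‖T p.1 x - T t x‖ :=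
        (norm_add_le _ _).trans (add_le_add_left ((T p.1).le_opNorm _) _)
    _ ≤ _ := by gcongr; exact hM _ ⟨hp.1, hp1.le⟩

/-- The averages `h⁻¹ ∫_a^{a+h} T(s) x ds` converge to `T(a) x` as `h → 0+`. -/
lemma tendsto_average (hT : IsC0Semigroup T) (x : Z) {a : ℝ} (ha : 0 ≤ a) :
    Tendsto (fun h : ℝ => h⁻¹ • ∫ s in a..(a + h), T s x) (𝓝[>] 0) (𝓝 (T a x)) := by
  have hc : ContinuousOn (fun s => T s x) (Ici a) :=
    (hT.continuousOn x).mono (Ici_subset_Ici.2 ha)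
  have h1 : HasDerivWithinAt (fun u => ∫ s in a..u, T s x) (T a x) (Ici a) a :=
    intervalIntegral.integral_hasDerivWithinAt_right (hT.intervalIntegrable x ha ha)
      (hc.stronglyMeasurableAtFilter_nhdsWithin measurableSet_Ici a |>.filter_mono
        (nhdsWithin_mono _ Ioi_subset_Ici_self))
      ((hc a self_mem_Ici).mono Ioi_subset_Ici_self)
  have h2 := (hasDerivWithinAt_iff_tendsto_slope' (self_notMem_Ioi)).1
    (h1.mono Ioi_subset_Ici_self)
  have h3 : Tendsto (fun h : ℝ => a + h) (𝓝[>] 0) (𝓝[>] a) := by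
    refine tendsto_nhdsWithin_iff.2 ⟨?_, ?_⟩
    · have : Continuous fun h : ℝ => a + h := by fun_prop
      simpa using (this.tendsto 0).mono_left nhdsWithin_le_nhds
    · filter_upwards [self_mem_nhdsWithin] with h hh
      simpa using hh
  refine (h2.comp h3).congr fun h => ?_
  simp [slope_def_module]

/-- `∫_0^h T(s) x ds` lies in the domain of the generator, which maps it to `T(h) x - x`. -/
lemma tendsto_generator_integral (hT : IsC0Semigroup T) (x : Z) {h : ℝ} (hh : 0 ≤ h) :
    Tendsto (fun r : ℝ => r⁻¹ • (T r (∫ s in (0 : ℝ)..h, T s x) - ∫ s in (0 : ℝ)..h, T s x))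
      (𝓝[>] 0) (𝓝 (T h x - x)) := by
  have h0 : T 0 x = x := by rw [hT.zero]; rfl
  have key := (hT.tendsto_average x hh).sub (hT.tendsto_average x le_rfl)
  rw [h0] at key
  refine key.congr' ?_
  filter_upwards [self_mem_nhdsWithin] with r hr
  have hr : 0 < r := hr
  have e1 : T r (∫ s in (0 : ℝ)..h, T s x) = ∫ s in r..(h + r), T s x := by
    rw [← (T r).intervalIntegral_comp_comm (hT.intervalIntegrable x le_rfl hh)]
    have : ∫ s in (0 : ℝ)..h, T (s + r) x = ∫ s in r..(h + r), T s x := by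
      rw [intervalIntegral.integral_comp_add_right (fun s => T s x), zero_add]
    rw [← this]
    refine intervalIntegral.integral_congr fun s hs => ?_
    rw [uIcc_of_le hh] at hs
    rw [add_comm s r, hT.add r s hr.le hs.1]
    rfl
  have i := fun {a b : ℝ} (ha : 0 ≤ a) (hb : 0 ≤ b) => hT.intervalIntegrable x ha hb
  have e2 := intervalIntegral.integral_add_adjacent_intervals
    (i le_rfl hr.le) (i hr.le (by positivity : 0 ≤ h + r))
  have e3 := intervalIntegral.integral_add_adjacent_intervals
    (i le_rfl hh) (i hh (by positivity : 0 ≤ h + r))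
  rw [e1, ← smul_sub, zero_add]
  congr 1
  rw [sub_eq_sub_iff_add_eq_add, add_comm, e3, ← e2, add_comm]

variable {Y : Type*} [NormedAddCommGroup Y] [NormedSpace ℝ Y] [CompleteSpace Y]

/-- The averages of the Duhamel term converge to the inhomogeneity. -/
lemma tendsto_average_duhamel (hT : IsC0Semigroup T) {F : ℝ → Z} (hF : Continuous F) (t : ℝ) :
    Tendsto (fun h : ℝ => h⁻¹ • ∫ s in t..(t + h), T (t + h - s) (F s)) (𝓝[>] 0)
      (𝓝 (F t)) := by
  have h0 : T 0 (F t) = F t := by rw [hT.zero]; rfl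
  rw [Metric.tendsto_nhds]
  intro δ hδ
  have hc := hT.continuousOn_uncurry (0, F t) ⟨self_mem_Ici, mem_univ _⟩
  rw [ContinuousWithinAt, h0, nhdsWithin_prod_eq, nhdsWithin_univ] at hc
  have hev := hc (Metric.closedBall_mem_nhds (F t) (half_pos hδ))
  rw [mem_map, mem_prod_iff] at hev
  obtain ⟨U, hU, W, hW, hUW⟩ := hev
  obtain ⟨η₁, hη₁, hU'⟩ := Metric.mem_nhdsWithin_iff.1 hU
  obtain ⟨η₂, hη₂, hW'⟩ := Metric.mem_nhds_iff.1 (hF.continuousAt hW)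
  filter_upwards [Ioo_mem_nhdsGT (lt_min hη₁ hη₂)] with h hh
  have hh0 : 0 < h := hh.1
  have hcont : ContinuousOn (fun s => T (t + h - s) (F s)) (uIcc t (t + h)) := by
    refine hT.continuousOn_uncurry.comp
      (f := fun s => (t + h - s, F s)) (by fun_prop) fun s hs => ⟨?_, mem_univ _⟩
    rw [uIcc_of_le (by linarith)] at hs
    simpa using hs.2
  have e : (∫ s in t..(t + h), T (t + h - s) (F s)) - h • F t
      = ∫ s in t..(t + h), (T (t + h - s) (F s) - F t) := by
    rw [intervalIntegral.integral_sub hcont.intervalIntegrable intervalIntegrable_const]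
    simp
  have hb : ‖∫ s in t..(t + h), (T (t + h - s) (F s) - F t)‖ ≤ δ / 2 * |t + h - t| := by
    refine intervalIntegral.norm_integral_le_of_norm_le_const fun s hs => ?_
    rw [uIoc_of_le (by linarith)] at hs
    rw [← dist_eq_norm]
    refine hUW (a := (t + h - s, F s)) ⟨hU' ⟨?_, ?_⟩, hW' ?_⟩
    · rw [Metric.mem_ball, Real.dist_eq, abs_lt]
      have := hh.2.trans_le (min_le_left _ _)
      constructor <;> linarith [hs.1, hs.2]
    · simpa using hs.2
    · rw [Metric.mem_ball, Real.dist_eq, abs_lt]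
      have := hh.2.trans_le (min_le_right _ _)
      constructor <;> linarith [hs.1, hs.2]
  rw [dist_eq_norm]
  have e2 : h⁻¹ • (∫ s in t..(t + h), T (t + h - s) (F s)) - F t
      = h⁻¹ • ((∫ s in t..(t + h), T (t + h - s) (F s)) - h • F t) := by
    rw [smul_sub, smul_smul, inv_mul_cancel₀ hh0.ne', one_smul]
  rw [e2, e, norm_smul, norm_inv, Real.norm_eq_abs, abs_of_pos hh0, inv_mul_lt_iff₀ hh0]
  rw [add_sub_cancel_left, abs_of_pos hh0] at hb
  nlinarith

/-- A mild solution of `z' = L z + F` satisfies the equation classically in every space `Y` (reached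
through `J`) on which the generator `L` extends to a bounded operator `G`. -/
lemma hasDerivAt_mild (hT : IsC0Semigroup T) {J G : Z →L[ℝ] Y}
    (hG : ∀ x y : Z, Tendsto (fun r : ℝ => r⁻¹ • (T r x - x)) (𝓝[>] 0) (𝓝 y) → J y = G x)
    {z F : ℝ → Z} (hz : Continuous z) (hF : Continuous F)
    (h : ∀ t₀ t : ℝ, t₀ ≤ t → z t = T (t - t₀) (z t₀) + ∫ s in t₀..t, T (t - s) (F s)) (t : ℝ) :
    HasDerivAt (fun s => J (z s)) (G (z t) + J (F t)) t := by
  refine hasDerivAt_of_right_deriv (d := fun t => G (z t) + J (F t)) (by fun_prop) (by fun_prop)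
    (fun t => ?_) t
  have h0 : T 0 (z t) = z t := by rw [hT.zero]; rfl
  have h1 := (G.continuous.tendsto _).comp (hT.tendsto_average (z t) le_rfl)
  have h2 := (J.continuous.tendsto _).comp (hT.tendsto_average_duhamel hF t)
  rw [h0] at h1
  have h3 : Tendsto (fun r : ℝ => r⁻¹ • (J (z (t + r)) - J (z t))) (𝓝[>] 0)
      (𝓝 (G (z t) + J (F t))) := by
    refine (h1.add h2).congr' ?_
    filter_upwards [self_mem_nhdsWithin] with r hr
    have hr : 0 < r := hr
    rw [h t (t + r) (by linarith)]
    have e := hG _ _ (hT.tendsto_generator_integral (z t) hr.le)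
    simp only [Function.comp_apply, zero_add, add_sub_cancel_left, map_add, map_smul, ← e,
      map_sub, smul_add, smul_sub]
    abel
  rw [← hasDerivWithinAt_Ioi_iff_Ici, hasDerivWithinAt_iff_tendsto_slope' self_notMem_Ioi]
  have h4 : Tendsto (fun s : ℝ => s - t) (𝓝[>] t) (𝓝[>] 0) := by
    refine tendsto_nhdsWithin_iff.2 ⟨?_, ?_⟩
    · have : Continuous fun s : ℝ => s - t := by fun_prop
      simpa using (this.tendsto t).mono_left nhdsWithin_le_nhds
    · filter_upwards [self_mem_nhdsWithin] with s hs
      simpa using hs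
  refine (h3.comp h4).congr fun s => ?_
  simp [slope_def_module]

end IsC0Semigroup

variable {Ω : Opens E3}

/-! ### The wave operator as a bounded operator from `H_1 × H_0` to `H_0 × H_{-1}` -/

/-- The elements of `H_1` that are represented by test functions are dense in `H_1`. -/
lemma H1.dense_testFunctions (P : Coefficients Ω) :
    Dense {ζ : H1 P | ∃ φ : 𝓓(Ω, ℝ),
      H1.toL2 ζ =ᵐ[leb Ω] φ ∧ H1.grad ζ =ᵐ[leb Ω] ∇ φ} := by
  have h1 : Dense {p : H10 Ω | (p : GraphSpace Ω) ∈ testGraph Ω} := by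
    rw [Subtype.dense_iff]
    intro p hp
    refine closure_mono ?_ hp
    intro q hq
    exact ⟨⟨q, subset_closure hq⟩, hq, rfl⟩
  exact h1.preimage (H1.toH10 P).toHomeomorph.isOpenMap

lemma H1.inner_eq {P : Coefficients Ω} (u ζ : H1 P) : ⟪u, ζ⟫_ℝ
    = (∫ x in (Ω : Set E3), ∑ i, ∑ j, P.a i j x * H1.grad u x j * H1.grad ζ x i)
      + ∫ x in (Ω : Set E3), P.β x * H1.toL2 u x * H1.toL2 ζ x := rfl

lemma Hneg1.ofL2_apply {P : Coefficients Ω} (h : L2 Ω) (ζ : H1 P) :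
    Hneg1.ofL2 P h ζ = ⟪h, H1.toL2 ζ⟫_ℝ := rfl

/-- If `βu - ∑ (a_{ij} u_{x_j})_{x_i} = h ∈ L²(Ω)` in the sense of distributions, then the functional
`⟨u, ·⟩_{H_1}` is represented by `h`. -/
lemma IsEllipticImage.innerSL_eq {P : Coefficients Ω} {u : H1 P} {h : L2 Ω}
    (hu : IsEllipticImage P u h) : innerSL ℝ u = Hneg1.ofL2 P h := by
  refine DFunLike.coe_injective ((innerSL ℝ u).continuous.ext_on (H1.dense_testFunctions P)
    (Hneg1.ofL2 P h).continuous ?_)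
  rintro ζ ⟨φ, h1, h2⟩
  rw [innerSL_apply_apply, Hneg1.ofL2_apply, H1.inner_eq, L2.inner_def]
  have e1 : ∫ x in (Ω : Set E3), ∑ i, ∑ j, P.a i j x * H1.grad u x j * H1.grad ζ x i
      = ∫ x in (Ω : Set E3), ∑ i, ∑ j, P.a i j x * H1.grad u x j * (∇ φ x) i := by
    refine integral_congr_ae ?_
    filter_upwards [h2] with x hx
    simp only [hx]
  have e2 : ∫ x in (Ω : Set E3), P.β x * H1.toL2 u x * H1.toL2 ζ x
      = ∫ x in (Ω : Set E3), P.β x * H1.toL2 u x * φ x := by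
    refine integral_congr_ae ?_
    filter_upwards [h1] with x hx
    simp only [hx]
  rw [e1, e2, hu φ]
  refine integral_congr_ae ?_
  filter_upwards [h1] with x hx
  simp only [hx, RCLike.inner_apply, conj_trivial]
  simp [mul_comm]

noncomputable section

/-- The inclusion `H_1 × H_0 → H_0 × H_{-1}`. -/
def stateInclusion (P : Coefficients Ω) : (H1 P × L2 Ω) →L[ℝ] (L2 Ω × Hneg1 P) :=
  H1.toL2.prodMap (Hneg1.ofL2 P)

/-- The extension of `-B_ε` to a bounded operator from `H_1 × H_0` to `H_0 × H_{-1}`; the elliptic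
operator is replaced by the Riesz map `u ↦ ⟨u, ·⟩_{H_1}`. -/
def waveExtension (P : Coefficients Ω) (ε : ℝ) : (H1 P × L2 Ω) →L[ℝ] (L2 Ω × Hneg1 P) :=
  (ContinuousLinearMap.snd ℝ (H1 P) (L2 Ω)).prod
    (-(ε⁻¹ • (Hneg1.ofL2 P ∘L ContinuousLinearMap.snd ℝ (H1 P) (L2 Ω)
      + innerSL ℝ ∘L ContinuousLinearMap.fst ℝ (H1 P) (L2 Ω))))

end

lemma stateInclusion_apply (P : Coefficients Ω) (z : H1 P × L2 Ω) :
    stateInclusion P z = (H1.toL2 z.1, Hneg1.ofL2 P z.2) := rfl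

lemma waveExtension_apply (P : Coefficients Ω) (ε : ℝ) (z : H1 P × L2 Ω) :
    waveExtension P ε z = (z.2, -(ε⁻¹ • (Hneg1.ofL2 P z.2 + innerSL ℝ z.1))) := rfl

lemma IsWaveImage.stateInclusion_eq {P : Coefficients Ω} {ε : ℝ} {z y : H1 P × L2 Ω}
    (h : IsWaveImage P ε z y) : stateInclusion P y = -waveExtension P ε z := by
  obtain ⟨h1, k, hk, h2⟩ := h
  rw [stateInclusion_apply, waveExtension_apply, h1, h2, hk.innerSL_eq, map_add, map_smul,
    map_smul, Prod.neg_mk, neg_neg, smul_add]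

/-! ### The Sobolev inequality on `H¹₀(Ω)` and products of Sobolev functions -/

/-- The Sobolev inequality for the exponent `2` in dimension three. -/
lemma exists_eLpNorm_six_le_fderiv : ∃ C : NNReal, ∀ φ : E3 → ℝ, ContDiff ℝ 1 φ →
    HasCompactSupport φ → eLpNorm φ 6 volume ≤ C * eLpNorm (fderiv ℝ φ) 2 volume := by
  refine ⟨eLpNormLESNormFDerivOfEqInnerConst (volume : Measure E3) ((2 : NNReal) : ℝ),
    fun φ h1 h2 => ?_⟩
  have h3 : ((6 : NNReal) : ℝ)⁻¹ = ((2 : NNReal) : ℝ)⁻¹ - (Module.finrank ℝ E3 : ℝ)⁻¹ := by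
    simp only [finrank_euclideanSpace, Fintype.card_fin]
    norm_num
  exact eLpNorm_le_eLpNorm_fderiv_of_eq_inner volume h1 h2 (by norm_num) (by simp) h3

lemma exists_eLpNorm_six_testFunction_le (Ω : Opens E3) : ∃ C : NNReal, ∀ φ : 𝓓(Ω, ℝ),
    eLpNorm φ 6 (leb Ω) ≤ C * eLpNorm (∇ φ) 2 (leb Ω) := by
  obtain ⟨C, hC⟩ := exists_eLpNorm_six_le_fderiv
  refine ⟨C, fun φ => ?_⟩
  have h1 : Function.support (∇ φ) ⊆ (Ω : Set E3) := by
    intro x hx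
    refine φ.tsupport_subset (support_fderiv_subset ℝ fun h => hx ?_)
    rw [gradient, h, map_zero]
  have h2 : eLpNorm (fderiv ℝ φ) 2 volume = eLpNorm (∇ φ) 2 (leb Ω) := by
    rw [eLpNorm_restrict_eq_of_support_subset h1]
    exact eLpNorm_congr_norm_ae (Eventually.of_forall fun x =>
      ((toDual ℝ E3).symm.norm_map _).symm)
  rw [← h2]
  exact (eLpNorm_mono_measure _ Measure.restrict_le_self).trans
    (hC φ (φ.contDiff.of_le (by simp)) φ.hasCompactSupport)

/-- The Sobolev embedding `H¹₀(Ω) ⊆ L⁶(Ω)` in dimension three, valid on every open set `Ω`. -/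
lemma H1.exists_eLpNorm_six_le (P : Coefficients Ω) : ∃ S : ℝ, 0 ≤ S ∧ ∀ u : H1 P,
    eLpNorm (H1.toL2 u) 6 (leb Ω) ≤ ENNReal.ofReal (S * ‖u‖) := by
  obtain ⟨C, hC⟩ := exists_eLpNorm_six_testFunction_le Ω
  refine ⟨C * ‖(H1.grad : H1 P →L[ℝ] _)‖, by positivity, fun u => ?_⟩
  obtain ⟨s, hs, hlim⟩ := mem_closure_iff_seq_limit.1 (H1.dense_testFunctions P u)
  have h1 : Tendsto (fun n => H1.toL2 (s n)) atTop (𝓝 (H1.toL2 u)) :=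
    (H1.toL2.continuous.tendsto u).comp hlim
  obtain ⟨ns, hns, hae⟩ := (tendstoInMeasure_of_tendsto_Lp h1).exists_seq_tendsto_ae
  have h2 : ∀ n, eLpNorm (H1.toL2 (s n)) 6 (leb Ω)
      ≤ ENNReal.ofReal (C * ‖(H1.grad : H1 P →L[ℝ] _)‖ * ‖s n‖) := by
    intro n
    obtain ⟨φ, e1, e2⟩ := hs n
    rw [eLpNorm_congr_ae e1]
    refine (hC φ).trans ?_
    rw [← eLpNorm_congr_ae e2, ← Lp.enorm_def, ← ofReal_norm, ← ENNReal.ofReal_coe_nnreal,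
      ← ENNReal.ofReal_mul (by positivity), mul_assoc]
    exact ENNReal.ofReal_le_ofReal (by gcongr; exact H1.grad.le_opNorm _)
  have h3 := Lp.eLpNorm_lim_le_liminf_eLpNorm (p := 6)
    (fun n => (Lp.aestronglyMeasurable (H1.toL2 (s (ns n))))) _ hae
  refine h3.trans ?_
  have h4 : Tendsto (fun n => ENNReal.ofReal (C * ‖(H1.grad : H1 P →L[ℝ] _)‖ * ‖s (ns n)‖)) atTop
      (𝓝 (ENNReal.ofReal (C * ‖(H1.grad : H1 P →L[ℝ] _)‖ * ‖u‖))) :=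
    ENNReal.tendsto_ofReal ((hlim.comp hns.tendsto_atTop).norm.const_mul _)
  rw [← h4.liminf_eq]
  exact liminf_le_liminf (Eventually.of_forall fun n => h2 _)

/-- `q` is square integrable with `L²` norm at most `K`. -/
structure L2Bound {α : Type*} [MeasurableSpace α] (μ : Measure α) (q : α → ℝ) (K : ℝ) : Prop where
  nonneg : 0 ≤ K
  aestronglyMeasurable : AEStronglyMeasurable q μ
  eLpNorm_le : eLpNorm q 2 μ ≤ ENNReal.ofReal K

namespace L2Bound

variable {α : Type*} [MeasurableSpace α] {μ : Measure α} {q r : α → ℝ} {K K' : ℝ}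

lemma memLp (h : L2Bound μ q K) : MemLp q 2 μ :=
  ⟨h.aestronglyMeasurable, h.eLpNorm_le.trans_lt ENNReal.ofReal_lt_top⟩

lemma norm_toLp_le (h : L2Bound μ q K) : ‖h.memLp.toLp q‖ ≤ K := by
  rw [Lp.norm_toLp]
  exact ENNReal.toReal_le_of_le_ofReal h.nonneg h.eLpNorm_le

lemma norm_le (h : L2Bound μ q K) {g : Lp ℝ 2 μ} (hg : g =ᵐ[μ] q) : ‖g‖ ≤ K := by
  rw [Lp.norm_def, eLpNorm_congr_ae hg]
  exact ENNReal.toReal_le_of_le_ofReal h.nonneg h.eLpNorm_le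

lemma of_Lp (g : Lp ℝ 2 μ) : L2Bound μ g ‖g‖ :=
  ⟨norm_nonneg _, Lp.aestronglyMeasurable g, by
    rw [Lp.norm_def, ENNReal.ofReal_toReal (Lp.eLpNorm_ne_top g)]⟩

lemma add (h : L2Bound μ q K) (h' : L2Bound μ r K') :
    L2Bound μ (fun x => q x + r x) (K + K') := by
  refine ⟨add_nonneg h.nonneg h'.nonneg, h.aestronglyMeasurable.add h'.aestronglyMeasurable, ?_⟩
  rw [ENNReal.ofReal_add h.nonneg h'.nonneg]
  exact (eLpNorm_add_le h.aestronglyMeasurable h'.aestronglyMeasurable one_le_two).trans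
    (add_le_add h.eLpNorm_le h'.eLpNorm_le)

lemma const_mul (h : L2Bound μ q K) {M : ℝ} (hM : 0 ≤ M) :
    L2Bound μ (fun x => M * q x) (M * K) := by
  refine ⟨mul_nonneg hM h.nonneg, h.aestronglyMeasurable.const_mul M, ?_⟩
  rw [ENNReal.ofReal_mul hM]
  refine (eLpNorm_const_smul_le (c := M) (f := q)).trans ?_
  rw [Real.enorm_of_nonneg hM]
  gcongr
  exact h.eLpNorm_le

lemma abs (h : L2Bound μ q K) : L2Bound μ (fun x => |q x|) K :=
  ⟨h.nonneg, continuous_abs.comp_aestronglyMeasurable h.aestronglyMeasurable, by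
    rw [eLpNorm_congr_norm_ae (g := q) (Eventually.of_forall fun x => by simp)]
    exact h.eLpNorm_le⟩

lemma mono (h : L2Bound μ q K) (hr : AEStronglyMeasurable r μ) (hle : ∀ᵐ x ∂μ, |r x| ≤ q x) :
    L2Bound μ r K :=
  ⟨h.nonneg, hr, (eLpNorm_mono_ae_real hle).trans h.eLpNorm_le⟩

lemma weaken (h : L2Bound μ q K) (hK : K ≤ K') : L2Bound μ q K' :=
  ⟨h.nonneg.trans hK, h.aestronglyMeasurable,
    h.eLpNorm_le.trans (ENNReal.ofReal_le_ofReal hK)⟩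

/-- The Cauchy-Schwarz inequality. -/
lemma abs_inner_le (h : L2Bound μ q K) (h' : L2Bound μ r K') {p : α → ℝ}
    (hp : ∀ᵐ x ∂μ, |p x| ≤ |q x * r x|) : |∫ x, p x ∂μ| ≤ K * K' := by
  have h1 : |∫ x, p x ∂μ| ≤ ∫ x, |q x| * |r x| ∂μ := by
    refine abs_integral_le_integral_abs.trans ?_
    refine integral_mono_of_nonneg (Eventually.of_forall fun x => abs_nonneg _)
      (h.abs.memLp.integrable_mul h'.abs.memLp) ?_
    filter_upwards [hp] with x hx
    rw [← abs_mul]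
    exact hx
  have h2 : ∫ x, |q x| * |r x| ∂μ = ⟪h'.abs.memLp.toLp, h.abs.memLp.toLp⟫_ℝ := by
    rw [L2.inner_def]
    refine integral_congr_ae ?_
    filter_upwards [h.abs.memLp.coeFn_toLp, h'.abs.memLp.coeFn_toLp] with x hx hx'
    rw [hx, hx']
    simp
  rw [h2] at h1
  refine h1.trans ((real_inner_le_norm _ _).trans ?_)
  rw [mul_comm K]
  exact mul_le_mul h'.abs.norm_toLp_le h.abs.norm_toLp_le (norm_nonneg _) h'.nonneg

end L2Bound

lemma eLpNorm_mul_mul_le {α : Type*} [MeasurableSpace α] {μ : Measure α} {f g h : α → ℝ}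
    (hf : AEStronglyMeasurable f μ) (hg : AEStronglyMeasurable g μ)
    (hh : AEStronglyMeasurable h μ) :
    eLpNorm (fun x => f x * g x * h x) 2 μ ≤ eLpNorm f 6 μ * eLpNorm g 6 μ * eLpNorm h 6 μ := by
  have i1 : ENNReal.HolderTriple 6 6 3 := ⟨by
    rw [← ENNReal.toReal_eq_toReal_iff' (by simp) (by simp), ENNReal.toReal_add (by simp) (by simp)]
    norm_num⟩
  have i2 : ENNReal.HolderTriple 3 6 2 := ⟨by
    rw [← ENNReal.toReal_eq_toReal_iff' (by simp) (by simp), ENNReal.toReal_add (by simp) (by simp)]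
    norm_num⟩
  have e1 : eLpNorm (f • g) 3 μ ≤ eLpNorm f 6 μ * eLpNorm g 6 μ :=
    eLpNorm_smul_le_mul_eLpNorm hg hf
  have e2 : eLpNorm ((f • g) • h) 2 μ ≤ eLpNorm (f • g) 3 μ * eLpNorm h 6 μ :=
    eLpNorm_smul_le_mul_eLpNorm hh (hf.mul hg)
  exact e2.trans (mul_le_mul' e1 le_rfl)

/-- Products of up to three functions of `H¹₀(Ω)` are square integrable. The product of three is
estimated by the Hölder and Sobolev inequalities, and the product of two reduces to that case. -/
lemma H1.exists_l2Bound (P : Coefficients Ω) : ∃ S : ℝ, 0 ≤ S ∧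
    (∀ u : H1 P, L2Bound (leb Ω) (H1.toL2 u) (S * ‖u‖)) ∧
    (∀ u v : H1 P, L2Bound (leb Ω) (fun x => H1.toL2 u x * H1.toL2 v x) (S * (‖u‖ * ‖v‖))) ∧
    (∀ u v w : H1 P, L2Bound (leb Ω) (fun x => H1.toL2 u x * H1.toL2 v x * H1.toL2 w x)
      (S * (‖u‖ * ‖v‖ * ‖w‖))) := by
  obtain ⟨s, hs0, hs⟩ := H1.exists_eLpNorm_six_le P
  set N : ℝ := ‖(H1.toL2 : H1 P →L[ℝ] L2 Ω)‖ with hN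
  set S : ℝ := max N (s ^ 3) with hS
  have hN0 : 0 ≤ N := ContinuousLinearMap.opNorm_nonneg _
  have hS0 : 0 ≤ S := hN0.trans (le_max_left _ _)
  have m := fun u : H1 P => Lp.aestronglyMeasurable (H1.toL2 u)
  have t1 : ∀ u : H1 P, L2Bound (leb Ω) (H1.toL2 u) (S * ‖u‖) := fun u =>
    (L2Bound.of_Lp (H1.toL2 u)).weaken
      ((H1.toL2.le_opNorm u).trans (by gcongr; exact le_max_left _ _))
  have t3 : ∀ u v w : H1 P, L2Bound (leb Ω) (fun x => H1.toL2 u x * H1.toL2 v x * H1.toL2 w x)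
      (S * (‖u‖ * ‖v‖ * ‖w‖)) := by
    intro u v w
    refine ⟨by positivity, ((m u).mul (m v)).mul (m w), ?_⟩
    refine (eLpNorm_mul_mul_le (m u) (m v) (m w)).trans
      ((mul_le_mul' (mul_le_mul' (hs u) (hs v)) (hs w)).trans ?_)
    rw [← ENNReal.ofReal_mul (by positivity), ← ENNReal.ofReal_mul (by positivity)]
    refine ENNReal.ofReal_le_ofReal ?_
    calc s * ‖u‖ * (s * ‖v‖) * (s * ‖w‖) = s ^ 3 * (‖u‖ * ‖v‖ * ‖w‖) := by ring
      _ ≤ _ := by gcongr; exact le_max_right _ _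
  refine ⟨S, hS0, t1, fun u v => ?_, t3⟩
  have hm : AEStronglyMeasurable (fun x => H1.toL2 u x * H1.toL2 v x) (leb Ω) := (m u).mul (m v)
  rcases eq_or_ne u 0 with rfl | hu
  · refine ⟨by positivity, hm, ?_⟩
    have e0 : (fun x => H1.toL2 (0 : H1 P) x * H1.toL2 v x) =ᵐ[leb Ω] 0 := by
      rw [map_zero]
      filter_upwards [Lp.coeFn_zero ℝ 2 (leb Ω)] with x hx
      rw [hx, Pi.zero_apply, zero_mul]
    rw [eLpNorm_congr_ae e0]
    simp
  · -- `|u| ≤ (δ + δ⁻¹ |u|²) / 2` with `δ = ‖u‖` gives the right homogeneity.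
    have hδ : 0 < ‖u‖ := norm_pos_iff.2 hu
    have h1 := (((t1 v).abs.const_mul hδ.le).add
      ((t3 u u v).abs.const_mul (inv_nonneg.2 hδ.le))).const_mul (show (0 : ℝ) ≤ 1 / 2 by norm_num)
    refine (h1.mono hm (Eventually.of_forall fun x => ?_)).weaken (le_of_eq ?_)
    · simp only [abs_mul]
      have h2 : |H1.toL2 u x| ≤ 1 / 2 * (‖u‖ + ‖u‖⁻¹ * (|H1.toL2 u x| * |H1.toL2 u x|)) := by
        have h3 : ‖u‖ * |H1.toL2 u x|
            ≤ ‖u‖ * (1 / 2 * (‖u‖ + ‖u‖⁻¹ * (|H1.toL2 u x| * |H1.toL2 u x|))) := by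
          have h4 : ‖u‖ * (1 / 2 * (‖u‖ + ‖u‖⁻¹ * (|H1.toL2 u x| * |H1.toL2 u x|)))
              = 1 / 2 * (‖u‖ ^ 2 + |H1.toL2 u x| ^ 2) := by
            field_simp
          rw [h4]
          nlinarith [sq_nonneg (‖u‖ - |H1.toL2 u x|)]
        exact le_of_mul_le_mul_left h3 hδ
      calc |H1.toL2 u x| * |H1.toL2 v x|
          ≤ 1 / 2 * (‖u‖ + ‖u‖⁻¹ * (|H1.toL2 u x| * |H1.toL2 u x|)) * |H1.toL2 v x| := by gcongr
        _ = _ := by ring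
    · field_simp
      ring

/-! ### Pointwise bounds for the nonlinearity -/

lemma abs_le_add_of_mem_uIcc {a b s : ℝ} (hs : s ∈ uIcc b a) : |s| ≤ |a| + |b| := by
  rcases mem_uIcc.1 hs with h | h
  · exact (abs_le_max_abs_abs h.1 h.2).trans
      ((max_le_add_of_nonneg (abs_nonneg _) (abs_nonneg _)).trans_eq (add_comm _ _))
  · exact (abs_le_max_abs_abs h.1 h.2).trans
      (max_le_add_of_nonneg (abs_nonneg _) (abs_nonneg _))

lemma abs_deriv_sub_le {φ : ℝ → ℝ} (hφ : ContDiff ℝ 2 φ) {C : ℝ}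
    (hC : ∀ u, |iteratedDeriv 2 φ u| ≤ C * (1 + |u|)) (hC0 : 0 ≤ C) (a b : ℝ) :
    |deriv φ a - deriv φ b| ≤ C * (1 + |a| + |b|) * |a - b| := by
  have hd : Differentiable ℝ (deriv φ) := by
    have h := hφ.differentiable_iteratedDeriv 1 (by norm_num)
    rwa [iteratedDeriv_one] at h
  refine (convex_uIcc b a).norm_image_sub_le_of_norm_deriv_le (f := deriv φ)
    (fun s _ => hd s) (fun s hs => ?_) left_mem_uIcc right_mem_uIcc
  have h1 := hC s
  rw [iteratedDeriv_succ, iteratedDeriv_one] at h1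
  refine h1.trans (mul_le_mul_of_nonneg_left ?_ hC0)
  linarith [abs_le_add_of_mem_uIcc hs]

/-- The bounds on `f(x, ·)` and its derivative that follow from the growth of its second
derivative. -/
structure CubicBounds (φ : ℝ → ℝ) (M : ℝ) : Prop where
  differentiable : Differentiable ℝ φ
  deriv_le : ∀ a, |deriv φ a| ≤ M * (1 + a * a)
  deriv_sub_le : ∀ a b, |deriv φ a - deriv φ b| ≤ M * (1 + |a| + |b|) * |a - b|
  sub_le : ∀ a b, |φ a - φ b| ≤ M * (1 + a * a + b * b) * |a - b|
  taylor_le : ∀ a b, |φ a - φ b - deriv φ b * (a - b)| ≤ M * (1 + |a| + |b|) * |a - b| * |a - b|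

lemma cubicBounds {φ : ℝ → ℝ} (hφ : ContDiff ℝ 2 φ) {C m : ℝ} (hC0 : 0 ≤ C) (hm : 0 ≤ m)
    (hC : ∀ u, |iteratedDeriv 2 φ u| ≤ C * (1 + |u|)) (h0 : |deriv φ 0| ≤ m) :
    CubicBounds φ (2 * m + 4 * C) := by
  have hd : Differentiable ℝ φ := hφ.differentiable (by norm_num)
  have b1 := abs_deriv_sub_le hφ hC hC0
  have b2 : ∀ a, |deriv φ a| ≤ (m + 2 * C) * (1 + a * a) := by
    intro a
    have h1 := b1 a 0
    have h2 := abs_sub_abs_le_abs_sub (deriv φ a) (deriv φ 0)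
    simp only [abs_zero, sub_zero, add_zero] at h1
    have h3 : (1 + |a|) * |a| ≤ 2 * (1 + a * a) := by
      nlinarith [sq_nonneg (|a| - 1), abs_mul_abs_self a]
    have h4 : C * (1 + |a|) * |a| ≤ C * (2 * (1 + a * a)) := by
      rw [mul_assoc]; exact mul_le_mul_of_nonneg_left h3 hC0
    nlinarith [mul_nonneg hm (mul_self_nonneg a)]
  refine ⟨hd, fun a => (b2 a).trans ?_, fun a b => (b1 a b).trans ?_, fun a b => ?_, fun a b => ?_⟩
  · exact mul_le_mul_of_nonneg_right (by linarith) (add_nonneg zero_le_one (mul_self_nonneg a))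
  · gcongr; linarith
  · refine (convex_uIcc b a).norm_image_sub_le_of_norm_deriv_le (f := φ)
      (fun s _ => hd s) (fun s hs => ?_) left_mem_uIcc right_mem_uIcc
    refine (b2 s).trans ?_
    have h1 := abs_le_add_of_mem_uIcc hs
    have h2 : s * s ≤ 2 * (a * a + b * b) := by
      rw [← abs_mul_abs_self s, ← abs_mul_abs_self a, ← abs_mul_abs_self b]
      nlinarith [abs_nonneg s, abs_nonneg a, abs_nonneg b, sq_nonneg (|a| - |b|)]
    have h3 : 0 ≤ m + 2 * C := by positivity
    nlinarith [mul_le_mul_of_nonneg_left h2 h3]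
  · have hdg : ∀ s, HasDerivAt (fun s => φ s - deriv φ b * s) (deriv φ s - deriv φ b) s := by
      intro s
      have h := (hd s).hasDerivAt.sub ((hasDerivAt_id s).const_mul (deriv φ b))
      rw [mul_one] at h
      exact h
    have key := (convex_uIcc b a).norm_image_sub_le_of_norm_hasDerivWithin_le
      (f := fun s => φ s - deriv φ b * s) (f' := fun s => deriv φ s - deriv φ b)
      (C := (2 * m + 4 * C) * (1 + |a| + |b|) * |a - b|)
      (fun s _ => (hdg s).hasDerivWithinAt) (fun s hs => ?_) left_mem_uIcc right_mem_uIcc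
    · refine le_trans (le_of_eq ?_) key
      rw [Real.norm_eq_abs]
      congr 1
      ring
    · refine (b1 s b).trans ?_
      have h1 := abs_le_add_of_mem_uIcc hs
      have h2 : |s - b| ≤ |a - b| := abs_sub_left_of_mem_uIcc hs
      have h3 : 1 + |s| + |b| ≤ 2 * (1 + |a| + |b|) := by
        linarith [abs_nonneg a]
      calc C * (1 + |s| + |b|) * |s - b| ≤ C * (2 * (1 + |a| + |b|)) * |a - b| := by gcongr
        _ = (2 * C) * (1 + |a| + |b|) * |a - b| := by ring
        _ ≤ _ := by gcongr; linarith

lemma IsNonlinearity.exists_cubicBounds {f : E3 → ℝ → ℝ} (hf : IsNonlinearity Ω f) :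
    ∃ M, 0 ≤ M ∧ ∀ᵐ x ∂(leb Ω), CubicBounds (f x) M := by
  obtain ⟨C, hC0, hC⟩ := hf.growth
  have h0 := ae_le_eLpNormEssSup (f := fun x => deriv (f x) 0) (μ := leb Ω)
  have hfin : eLpNormEssSup (fun x => deriv (f x) 0) (leb Ω) ≠ ∞ := by
    simpa using hf.memLp_deriv_zero.2.ne
  refine ⟨2 * (eLpNormEssSup (fun x => deriv (f x) 0) (leb Ω)).toReal + 4 * C, by positivity, ?_⟩
  filter_upwards [hf.contDiff, hC, h0] with x h1 h2 h3
  refine cubicBounds h1 hC0 ENNReal.toReal_nonneg h2 ?_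
  rw [← Real.norm_eq_abs, ← toReal_enorm]
  exact ENNReal.toReal_mono hfin h3

/-! ### Measurability of superpositions -/

/-- A Carathéodory function may be superposed with a measurable function. -/
lemma aemeasurable_superposition {α : Type*} [MeasurableSpace α] {μ : Measure α} {f : α → ℝ → ℝ}
    (hf : ∀ c, AEMeasurable (fun x => f x c) μ) (hc : ∀ᵐ x ∂μ, Continuous (f x)) {u : α → ℝ}
    (hu : AEStronglyMeasurable u μ) : AEMeasurable (fun x => f x (u x)) μ := by
  obtain ⟨v, hv, huv⟩ := hu
  have hstep : ∀ n, AEMeasurable (fun x => f x (hv.approx n x)) μ := by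
    intro n
    have e : (fun x => f x (hv.approx n x)) = fun x => ∑ c ∈ (hv.approx n).range,
        (hv.approx n ⁻¹' {c}).indicator (fun x => f x c) x := by
      funext x
      rw [Finset.sum_eq_single (hv.approx n x)]
      · rw [indicator_of_mem (by simp)]
      · intro c _ hc
        rw [indicator_of_notMem]
        simpa using hc.symm
      · intro h
        exact absurd ((hv.approx n).mem_range_self x) h
    rw [e]
    exact Finset.aemeasurable_fun_sum _ fun c _ =>
      (hf c).indicator ((hv.approx n).measurableSet_fiber c)
  refine aemeasurable_of_tendsto_metrizable_ae atTop hstep ?_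
  filter_upwards [hc, huv] with x h1 h2
  rw [h2]
  exact (h1.tendsto _).comp (hv.tendsto_approx x)

lemma aemeasurable_deriv_superposition {α : Type*} [MeasurableSpace α] {μ : Measure α}
    {f : α → ℝ → ℝ} (hf : ∀ c, AEMeasurable (fun x => f x c) μ)
    (hd : ∀ᵐ x ∂μ, Differentiable ℝ (f x)) {u : α → ℝ} (hu : AEStronglyMeasurable u μ) :
    AEMeasurable (fun x => deriv (f x) (u x)) μ := by
  have hc : ∀ᵐ x ∂μ, Continuous (f x) := hd.mono fun x h => h.continuous
  refine aemeasurable_of_tendsto_metrizable_ae atTop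
    (f := fun (n : ℕ) x => (1 / ((n : ℝ) + 1))⁻¹ * (f x (u x + 1 / ((n : ℝ) + 1)) - f x (u x)))
    (fun n => ((aemeasurable_superposition hf hc (hu.add aestronglyMeasurable_const)).sub
      (aemeasurable_superposition hf hc hu)).const_mul _) ?_
  filter_upwards [hd] with x hx
  have h1 := (hx (u x)).hasDerivAt.tendsto_slope_zero
  have h2 : Tendsto (fun n : ℕ => 1 / ((n : ℝ) + 1)) atTop (𝓝[≠] 0) :=
    tendsto_nhdsWithin_iff.2 ⟨tendsto_one_div_add_atTop_nhds_zero_nat,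
      Eventually.of_forall fun n => (by positivity : (0 : ℝ) < 1 / ((n : ℝ) + 1)).ne'⟩
  exact h1.comp h2

/-! ### The Nemitski operator and its derivative -/

/-- A function that multiplies `H_1` into `H_0` defines a bounded operator. -/
lemma exists_mulOperator {P : Coefficients Ω} {W : E3 → ℝ} {K : ℝ}
    (h : ∀ ζ : H1 P, L2Bound (leb Ω) (fun x => W x * H1.toL2 ζ x) (K * ‖ζ‖)) :
    ∃ A : H1 P →L[ℝ] L2 Ω, ∀ ζ, A ζ =ᵐ[leb Ω] fun x => W x * H1.toL2 ζ x := by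
  let A : H1 P →ₗ[ℝ] L2 Ω :=
    { toFun := fun ζ => (h ζ).memLp.toLp
      map_add' := fun ζ η => by
        refine Lp.ext ?_
        have e : (H1.toL2 (ζ + η) : E3 → ℝ) =ᵐ[leb Ω] H1.toL2 ζ + H1.toL2 η := by
          rw [map_add]; exact Lp.coeFn_add _ _
        filter_upwards [(h (ζ + η)).memLp.coeFn_toLp, (h ζ).memLp.coeFn_toLp,
          (h η).memLp.coeFn_toLp, e,
          Lp.coeFn_add ((h ζ).memLp.toLp) ((h η).memLp.toLp)] with x h1 h2 h3 h4 h5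
        rw [h1, h5, Pi.add_apply, h2, h3, h4, Pi.add_apply, mul_add]
      map_smul' := fun c ζ => by
        refine Lp.ext ?_
        have e : (H1.toL2 (c • ζ) : E3 → ℝ) =ᵐ[leb Ω] c • H1.toL2 ζ := by
          rw [map_smul]; exact Lp.coeFn_smul _ _
        filter_upwards [(h (c • ζ)).memLp.coeFn_toLp, (h ζ).memLp.coeFn_toLp, e,
          Lp.coeFn_smul c ((h ζ).memLp.toLp)] with x h1 h2 h3 h4
        rw [h1, RingHom.id_apply, h4, Pi.smul_apply, h2, h3, Pi.smul_apply, smul_eq_mul,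
          smul_eq_mul]
        ring }
  exact ⟨A.mkContinuous K fun ζ => (h ζ).norm_toLp_le, fun ζ => (h ζ).memLp.coeFn_toLp⟩

lemma H1.coeFn_sub {P : Coefficients Ω} (u v : H1 P) :
    H1.toL2 (u - v) =ᵐ[leb Ω] fun x => H1.toL2 u x - H1.toL2 v x := by
  rw [map_sub]
  exact Lp.coeFn_sub _ _

/-- For `u ∈ H_1` the difference of two superpositions is controlled in `L²`. -/
lemma IsNonlinearity.exists_l2Bound_sub {f : E3 → ℝ → ℝ} (hf : IsNonlinearity Ω f)
    (P : Coefficients Ω) : ∃ K, 0 ≤ K ∧ ∀ u v : H1 P, L2Bound (leb Ω)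
      (fun x => f x (H1.toL2 u x) - f x (H1.toL2 v x))
      (K * (1 + ‖u‖ ^ 2 + ‖v‖ ^ 2) * ‖u - v‖) := by
  obtain ⟨M, hM0, hM⟩ := hf.exists_cubicBounds
  obtain ⟨S, hS0, s1, s2, s3⟩ := H1.exists_l2Bound P
  have hc : ∀ᵐ x ∂(leb Ω), Continuous (f x) := hM.mono fun x h => h.differentiable.continuous
  have meas := fun u : H1 P =>
    aemeasurable_superposition hf.meas hc (Lp.aestronglyMeasurable (H1.toL2 u))
  refine ⟨M * S, by positivity, fun u v => ?_⟩
  have h1 := (((s1 (u - v)).abs.add (s3 u u (u - v)).abs).add (s3 v v (u - v)).abs).const_mul hM0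
  refine (h1.mono ((meas u).sub (meas v)).aestronglyMeasurable ?_).weaken (le_of_eq (by ring))
  filter_upwards [hM, H1.coeFn_sub u v] with x hx hd
  refine (hx.sub_le _ _).trans (le_of_eq ?_)
  simp only [hd, abs_mul, abs_mul_abs_self]
  ring

lemma IsNonlinearity.coeFn_nemitski {f : E3 → ℝ → ℝ} (hf : IsNonlinearity Ω f)
    {P : Coefficients Ω} (u : H1 P) :
    nemitski f (H1.toL2 u) =ᵐ[leb Ω] fun x => f x (H1.toL2 u x) := by
  obtain ⟨K, -, hK⟩ := hf.exists_l2Bound_sub P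
  have h0 : (fun x => f x (H1.toL2 (0 : H1 P) x)) =ᵐ[leb Ω] fun x => f x 0 := by
    rw [map_zero]
    filter_upwards [Lp.coeFn_zero ℝ 2 (leb Ω)] with x hx
    rw [hx, Pi.zero_apply]
  have h1 : MemLp (fun x => f x (H1.toL2 u x)) 2 (leb Ω) := by
    have h2 := (hK u 0).memLp.add ((memLp_congr_ae h0).2 hf.memLp_zero)
    refine (memLp_congr_ae (Eventually.of_forall fun x => ?_)).1 h2
    simp
  rw [nemitski, dif_pos h1]
  exact h1.coeFn_toLp

lemma IsNonlinearity.continuous_nemitski {f : E3 → ℝ → ℝ} (hf : IsNonlinearity Ω f)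
    (P : Coefficients Ω) : Continuous fun u : H1 P => nemitski f (H1.toL2 u) := by
  obtain ⟨K, -, hK⟩ := hf.exists_l2Bound_sub P
  refine continuous_iff_continuousAt.2 fun v => tendsto_iff_norm_sub_tendsto_zero.2 ?_
  have hlim : Tendsto (fun u : H1 P => K * (1 + ‖u‖ ^ 2 + ‖v‖ ^ 2) * ‖u - v‖) (𝓝 v) (𝓝 0) := by
    have : Continuous fun u : H1 P => K * (1 + ‖u‖ ^ 2 + ‖v‖ ^ 2) * ‖u - v‖ := by fun_prop
    simpa using this.tendsto v
  refine squeeze_zero (fun _ => norm_nonneg _) (fun u => (hK u v).norm_le ?_) hlim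
  filter_upwards [hf.coeFn_nemitski u, hf.coeFn_nemitski v,
    Lp.coeFn_sub (nemitski f (H1.toL2 u)) (nemitski f (H1.toL2 v))] with x h1 h2 h3
  rw [h3, Pi.sub_apply, h1, h2]

lemma IsNonlinearity.aestronglyMeasurable_deriv_mul {f : E3 → ℝ → ℝ} (hf : IsNonlinearity Ω f)
    {P : Coefficients Ω} (u ζ : H1 P) :
    AEStronglyMeasurable (fun x => deriv (f x) (H1.toL2 u x) * H1.toL2 ζ x) (leb Ω) := by
  obtain ⟨M, -, hM⟩ := hf.exists_cubicBounds
  exact (aemeasurable_deriv_superposition hf.meas (hM.mono fun x h => h.differentiable)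
    (Lp.aestronglyMeasurable _)).aestronglyMeasurable.mul (Lp.aestronglyMeasurable _)

/-- Multiplication by `∂_u f(·, u)` is a bounded operator `H_1 → H_0`. -/
lemma IsNonlinearity.exists_derivOperator {f : E3 → ℝ → ℝ} (hf : IsNonlinearity Ω f)
    {P : Coefficients Ω} (u : H1 P) : ∃ A : H1 P →L[ℝ] L2 Ω,
      ∀ ζ, A ζ =ᵐ[leb Ω] fun x => deriv (f x) (H1.toL2 u x) * H1.toL2 ζ x := by
  obtain ⟨M, hM0, hM⟩ := hf.exists_cubicBounds
  obtain ⟨S, hS0, s1, s2, s3⟩ := H1.exists_l2Bound P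
  refine exists_mulOperator (K := M * S * (1 + ‖u‖ ^ 2)) fun ζ => ?_
  have h1 := ((s1 ζ).abs.add (s3 u u ζ).abs).const_mul hM0
  refine (h1.mono (hf.aestronglyMeasurable_deriv_mul u ζ) ?_).weaken (le_of_eq (by ring))
  filter_upwards [hM] with x hx
  rw [abs_mul]
  refine (mul_le_mul_of_nonneg_right (hx.deriv_le _) (abs_nonneg _)).trans (le_of_eq ?_)
  simp only [abs_mul, abs_mul_abs_self]
  ring

lemma IsNonlinearity.exists_l2Bound_deriv_sub {f : E3 → ℝ → ℝ} (hf : IsNonlinearity Ω f)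
    (P : Coefficients Ω) : ∃ K, 0 ≤ K ∧ ∀ u v ζ : H1 P, L2Bound (leb Ω)
      (fun x => deriv (f x) (H1.toL2 u x) * H1.toL2 ζ x
        - deriv (f x) (H1.toL2 v x) * H1.toL2 ζ x)
      (K * (1 + ‖u‖ + ‖v‖) * ‖u - v‖ * ‖ζ‖) := by
  obtain ⟨M, hM0, hM⟩ := hf.exists_cubicBounds
  obtain ⟨S, hS0, s1, s2, s3⟩ := H1.exists_l2Bound P
  refine ⟨M * S, by positivity, fun u v ζ => ?_⟩
  have h1 := (((s2 (u - v) ζ).abs.add (s3 u (u - v) ζ).abs).add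
    (s3 v (u - v) ζ).abs).const_mul hM0
  refine (h1.mono ((hf.aestronglyMeasurable_deriv_mul u ζ).sub
    (hf.aestronglyMeasurable_deriv_mul v ζ)) ?_).weaken (le_of_eq (by ring))
  filter_upwards [hM, H1.coeFn_sub u v] with x hx hd
  rw [Pi.sub_apply, ← sub_mul, abs_mul]
  refine (mul_le_mul_of_nonneg_right (hx.deriv_sub_le _ _) (abs_nonneg _)).trans (le_of_eq ?_)
  simp only [hd, abs_mul]
  ring

lemma continuous_of_opNorm_sub_le {X Y : Type*} [NormedAddCommGroup X] [NormedSpace ℝ X]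
    [NormedAddCommGroup Y] [NormedSpace ℝ Y] {A : X → X →L[ℝ] Y} {K : ℝ}
    (h : ∀ u v, ‖A u - A v‖ ≤ K * (1 + ‖u‖ + ‖v‖) * ‖u - v‖) : Continuous A := by
  refine continuous_iff_continuousAt.2 fun v => tendsto_iff_norm_sub_tendsto_zero.2 ?_
  have hlim : Tendsto (fun u => K * (1 + ‖u‖ + ‖v‖) * ‖u - v‖) (𝓝 v) (𝓝 0) := by
    have : Continuous fun u => K * (1 + ‖u‖ + ‖v‖) * ‖u - v‖ := by fun_prop
    simpa using this.tendsto v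
  exact squeeze_zero (fun u => norm_nonneg _) (fun u => h u v) hlim

/-- Multiplication by `∂_u f(·, u)`, as a bounded operator `H_1 → H_0`, depends continuously, in the
operator norm, on `u ∈ H_1`. -/
lemma IsNonlinearity.continuous_derivOperator {f : E3 → ℝ → ℝ} (hf : IsNonlinearity Ω f)
    {P : Coefficients Ω} {A : H1 P → H1 P →L[ℝ] L2 Ω}
    (hA : ∀ u ζ, A u ζ =ᵐ[leb Ω] fun x => deriv (f x) (H1.toL2 u x) * H1.toL2 ζ x) :
    Continuous A := by
  obtain ⟨K, hK0, hK⟩ := hf.exists_l2Bound_deriv_sub P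
  have hlip : ∀ u v, ‖A u - A v‖ ≤ K * (1 + ‖u‖ + ‖v‖) * ‖u - v‖ := by
    intro u v
    refine ContinuousLinearMap.opNorm_le_bound _ (by positivity) fun ζ => (hK u v ζ).norm_le ?_
    filter_upwards [hA u ζ, hA v ζ, Lp.coeFn_sub (A u ζ) (A v ζ)] with x h1 h2 h3
    rw [_root_.sub_apply, h3, Pi.sub_apply, h1, h2]
  exact continuous_of_opNorm_sub_le hlip

/-- The second order Taylor estimate for the Nemitski operator as a map into `H_{-1}`. One of the two
factors `u - v` is measured in `L²` only, where a solution is differentiable in time. -/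
lemma IsNonlinearity.exists_taylor_bound {f : E3 → ℝ → ℝ} (hf : IsNonlinearity Ω f)
    {P : Coefficients Ω} {A : H1 P → H1 P →L[ℝ] L2 Ω}
    (hA : ∀ u ζ, A u ζ =ᵐ[leb Ω] fun x => deriv (f x) (H1.toL2 u x) * H1.toL2 ζ x) :
    ∃ K, 0 ≤ K ∧ ∀ u v : H1 P,
      ‖Hneg1.ofL2 P (nemitski f (H1.toL2 u) - nemitski f (H1.toL2 v) - A v (u - v))‖
        ≤ K * (1 + ‖u‖ + ‖v‖) * ‖u - v‖ * ‖H1.toL2 (u - v)‖ := by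
  obtain ⟨M, hM0, hM⟩ := hf.exists_cubicBounds
  obtain ⟨S, hS0, s1, s2, s3⟩ := H1.exists_l2Bound P
  refine ⟨M * S, by positivity, fun u v => ?_⟩
  refine ContinuousLinearMap.opNorm_le_bound _ (by positivity) fun ζ => ?_
  have h1 := (((s2 (u - v) ζ).abs.add (s3 u (u - v) ζ).abs).add
      (s3 v (u - v) ζ).abs).const_mul hM0
  rw [Hneg1.ofL2_apply, L2.inner_def, Real.norm_eq_abs]
  refine (h1.abs_inner_le (L2Bound.of_Lp (H1.toL2 (u - v))) ?_).trans (le_of_eq (by ring))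
  set n₁ := nemitski f (H1.toL2 u) with hn₁
  set n₂ := nemitski f (H1.toL2 v) with hn₂
  filter_upwards [hM, H1.coeFn_sub u v, hf.coeFn_nemitski u, hf.coeFn_nemitski v, hA v (u - v),
    Lp.coeFn_sub (n₁ - n₂) (A v (u - v)), Lp.coeFn_sub n₁ n₂] with x hx hd e1 e2 e3 e4 e5
  rw [e4, Pi.sub_apply, e5, Pi.sub_apply, hn₁, hn₂, e1, e2, e3]
  simp only [RCLike.inner_apply, conj_trivial, hd]
  rw [abs_mul]
  refine (mul_le_mul_of_nonneg_left (hx.taylor_le _ _) (abs_nonneg _)).trans (le_of_eq ?_)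
  rw [abs_mul, abs_of_nonneg (a := M * _) (by positivity)]
  simp only [abs_mul]
  ring

/-! ### Differentiability of the nonlinear term along a curve -/

lemma ofL2_derivOperator {f : E3 → ℝ → ℝ} {P : Coefficients Ω} {A : H1 P → H1 P →L[ℝ] L2 Ω}
    (hA : ∀ u ζ, A u ζ =ᵐ[leb Ω] fun x => deriv (f x) (H1.toL2 u x) * H1.toL2 ζ x) (u η : H1 P) :
    Hneg1.ofL2 P (A u η) = (innerSL ℝ (H1.toL2 η)).comp (A u) := by
  ext ζ
  rw [Hneg1.ofL2_apply, ContinuousLinearMap.comp_apply, innerSL_apply_apply, L2.inner_def,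
    L2.inner_def]
  refine integral_congr_ae ?_
  filter_upwards [hA u η, hA u ζ] with x h1 h2
  simp only [h1, h2, RCLike.inner_apply, conj_trivial]
  ring

/-- A chain rule for a map that is differentiable only with a loss of regularity: the Taylor remainder
is estimated by the norm of `V`, in which `u` is continuous, times the norm of the larger space `H`,
in which `u` is differentiable. -/
lemma hasDerivAt_of_taylor_bound {V H Z : Type*} [NormedAddCommGroup V] [NormedSpace ℝ V]
    [NormedAddCommGroup H] [NormedSpace ℝ H] [NormedAddCommGroup Z] [NormedSpace ℝ Z]
    {i : V →L[ℝ] H} {D : H →L[ℝ] Z} {u : ℝ → V} {y : ℝ → Z} {t K : ℝ} {v : H}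
    (hu : Continuous u) (hv : HasDerivAt (fun s => i (u s)) v t)
    (h : ∀ s, ‖y s - y t - D (i (u s - u t))‖
      ≤ K * (1 + ‖u s‖ + ‖u t‖) * ‖u s - u t‖ * ‖i (u s - u t)‖) :
    HasDerivAt y (D v) t := by
  have h1 : HasDerivAt (fun s => D (i (u s))) (D v) t := D.hasFDerivAt.comp_hasDerivAt t hv
  have h2 : HasDerivAt (fun s => y s - y t - D (i (u s - u t))) 0 t := by
    rw [hasDerivAt_iff_isLittleO]
    have hO : (fun s => i (u s - u t)) =O[𝓝 t] fun s => s - t := by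
      simpa only [map_sub] using hv.isBigO_sub
    have ho : (fun s => K * (1 + ‖u s‖ + ‖u t‖) * ‖u s - u t‖) =o[𝓝 t] fun _ => (1 : ℝ) := by
      rw [Asymptotics.isLittleO_one_iff]
      have : Continuous fun s => K * (1 + ‖u s‖ + ‖u t‖) * ‖u s - u t‖ := by fun_prop
      simpa using this.tendsto t
    have hm := ho.mul_isBigO hO.norm_left
    simp only [one_mul] at hm
    refine (Asymptotics.isBigO_of_le _ fun s => ?_).trans_isLittleO hm
    simp only [sub_self, map_zero, smul_zero, sub_zero]
    exact (h s).trans (le_abs_self _)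
  have h3 := (h2.add h1).add_const (y t - D (i (u t)))
  rw [zero_add] at h3
  refine h3.congr_of_eventuallyEq (Eventually.of_forall fun s => ?_)
  simp only [Pi.add_apply, map_sub]
  abel

/-- If `u` is continuous into `H_1` and differentiable into `H_0`, then `f(·, u)` is differentiable
into `H_{-1}`, with the derivative given by the chain rule. -/
lemma IsNonlinearity.hasDerivAt_nemitski {f : E3 → ℝ → ℝ} (hf : IsNonlinearity Ω f)
    {P : Coefficients Ω} {A : H1 P → H1 P →L[ℝ] L2 Ω}
    (hA : ∀ u ζ, A u ζ =ᵐ[leb Ω] fun x => deriv (f x) (H1.toL2 u x) * H1.toL2 ζ x)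
    {u : ℝ → H1 P} (hu : Continuous u) {t : ℝ} {v : L2 Ω}
    (hv : HasDerivAt (fun s => H1.toL2 (u s)) v t) :
    HasDerivAt (fun s => Hneg1.ofL2 P (nemitski f (H1.toL2 (u s)))) ((innerSL ℝ v).comp (A (u t)))
      t := by
  obtain ⟨K, hK0, hK⟩ := hf.exists_taylor_bound hA
  let D : L2 Ω →L[ℝ] Hneg1 P :=
    (ContinuousLinearMap.compL ℝ (H1 P) (L2 Ω) ℝ).flip (A (u t)) ∘L innerSL ℝ
  have hD : ∀ η : H1 P, Hneg1.ofL2 P (A (u t) η) = D (H1.toL2 η) := ofL2_derivOperator hA (u t)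
  refine hasDerivAt_of_taylor_bound (Z := Hneg1 P) (D := D) (K := K) hu hv fun s => ?_
  have h := hK (u s) (u t)
  rw [map_sub, map_sub, hD] at h
  exact h

/-! ### The energy identity -/

lemma continuous_innerSL_comp {V H : Type*} [NormedAddCommGroup V] [NormedSpace ℝ V]
    [NormedAddCommGroup H] [InnerProductSpace ℝ H] {v : ℝ → H} {A : ℝ → V →L[ℝ] H} (hv : Continuous v)
    (hA : Continuous A) : Continuous fun t => (innerSL ℝ (v t)).comp (A t) :=
  ((innerSL ℝ).continuous.comp hv).clm_comp hA

section Energy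

variable {V H : Type*} [NormedAddCommGroup V] [InnerProductSpace ℝ V] [CompleteSpace V]
  [NormedAddCommGroup H] [InnerProductSpace ℝ H]

/-- The inverse of the Riesz isomorphism of a real Hilbert space. It repackages `toDual.symm`, which is
conjugate-linear, as a linear map, so that derivatives can be pushed through it. -/
noncomputable def rieszInv (V : Type*) [NormedAddCommGroup V] [InnerProductSpace ℝ V]
    [CompleteSpace V] : StrongDual ℝ V →L[ℝ] V :=
  LinearMap.mkContinuous
    { toFun := fun w => (toDual ℝ V).symm w
      map_add' := fun w w' => map_add _ w w'
      map_smul' := fun c w => by simp } 1 fun w => by simp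

lemma rieszInv_apply (w : StrongDual ℝ V) : rieszInv V w = (toDual ℝ V).symm w := rfl

lemma inner_rieszInv (w : StrongDual ℝ V) (ζ : V) : ⟪rieszInv V w, ζ⟫_ℝ = w ζ := by
  rw [rieszInv_apply, toDual_symm_apply]

lemma rieszInv_innerSL (u : V) : rieszInv V (innerSL ℝ u) = u :=
  (toDual ℝ V).symm_apply_apply u

/-- The energy identity in `H × V'` for `ε η'' + η' + 𝒜 η = Φ`, where `𝒜 : V → V'` is the Riesz map of
`V ⊆ H`. The `V`-valued term is paired with the velocity in `V'`, and the result cancels the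
derivative of `½ |η|²`. -/
lemma hasDerivAt_energy {i : V →L[ℝ] H} {j : H →L[ℝ] StrongDual ℝ V}
    (hj : ∀ h ζ, j h ζ = ⟪h, i ζ⟫_ℝ) {ε : ℝ} (hε : 0 < ε) {η : ℝ → V} {ν : ℝ → H}
    {Φ : StrongDual ℝ V} {t : ℝ} (h1 : HasDerivAt (fun s => i (η s)) (ν t) t)
    (h2 : HasDerivAt (fun s => j (ν s)) (ε⁻¹ • (Φ - j (ν t) - innerSL ℝ (η t))) t) :
    HasDerivAt (fun s => 1 / 2 * ⟪i (η s), i (η s)⟫_ℝ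
        + 1 / 2 * ε * ⟪rieszInv V (j (ν s)), rieszInv V (j (ν s))⟫_ℝ)
      (-⟪rieszInv V (j (ν t)), rieszInv V (j (ν t))⟫_ℝ
        + ⟪rieszInv V Φ, rieszInv V (j (ν t))⟫_ℝ) t := by
  have h3 : HasDerivAt (fun s => rieszInv V (j (ν s))) _ t :=
    (rieszInv V).hasFDerivAt.comp_hasDerivAt t h2
  have h4 := ((h1.inner ℝ h1).const_mul (1 / 2)).add ((h3.inner ℝ h3).const_mul (1 / 2 * ε))
  refine h4.congr_deriv ?_
  have e1 : ⟪rieszInv V (j (ν t)), η t⟫_ℝ = ⟪ν t, i (η t)⟫_ℝ := by rw [inner_rieszInv, hj]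
  simp only [map_smul, map_sub, rieszInv_innerSL, inner_smul_left, inner_smul_right,
    inner_sub_left, inner_sub_right, e1, conj_trivial]
  rw [real_inner_comm (rieszInv V (j (ν t))) (η t), e1, real_inner_comm (ν t) (i (η t)),
    real_inner_comm (rieszInv V (j (ν t))) (rieszInv V Φ)]
  field_simp
  ring

/-! ### Passing to the limit in difference quotients -/

/-- If every difference quotient `δ` of a `C¹` curve `y` satisfies `(Q ∘ δ)' = R ∘ δ`, then so does the
derivative of `y`, although it need not be differentiable itself. -/
lemma hasDerivAt_of_differenceQuotient {E : Type*} [NormedAddCommGroup E] [NormedSpace ℝ E]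
    [CompleteSpace E] {y y' : ℝ → E} (hy : ∀ t, HasDerivAt y (y' t) t) (hy' : Continuous y')
    {Q R : E → ℝ} (hQ : Continuous Q) (hR : Continuous R)
    (h : ∀ r : ℝ, r ≠ 0 → ∀ t, HasDerivAt (fun s => Q (r⁻¹ • (y (s + r) - y s)))
      (R (r⁻¹ • (y (t + r) - y t))) t) (t : ℝ) :
    HasDerivAt (fun s => Q (y' s)) (R (y' t)) t := by
  -- `D (r, s)` is the difference quotient for `r ≠ 0`, and `y' s` for `r = 0`.
  let D : ℝ × ℝ → E := fun p => ∫ θ in (0 : ℝ)..1, y' (p.2 + p.1 * θ)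
  have hD : Continuous D :=
    intervalIntegral.continuous_parametric_intervalIntegral_of_continuous' (by fun_prop) _ _
  have hD0 : ∀ s, D (0, s) = y' s := fun s => by simp [D]
  have hDr : ∀ r s, r ≠ 0 → D (r, s) = r⁻¹ • (y (s + r) - y s) := by
    intro r s hr
    simp only [D]
    rw [intervalIntegral.integral_comp_add_mul y' hr, mul_zero, add_zero, mul_one,
      intervalIntegral.integral_eq_sub_of_hasDerivAt (fun τ _ => hy τ)
        (hy'.intervalIntegrable _ _)]
  have hcont : ∀ r, Continuous fun s => R (D (r, s)) := fun r =>
    hR.comp (hD.comp (by fun_prop))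
  have hint : ∀ s r, Q (D (r, s)) - Q (D (r, 0)) = ∫ τ in (0 : ℝ)..s, R (D (r, τ)) := by
    intro s
    have hc1 : Continuous fun r => Q (D (r, s)) - Q (D (r, 0)) :=
      (hQ.comp (hD.comp (by fun_prop))).sub (hQ.comp (hD.comp (by fun_prop)))
    have hc2 : Continuous fun r => ∫ τ in (0 : ℝ)..s, R (D (r, τ)) :=
      intervalIntegral.continuous_parametric_intervalIntegral_of_continuous'
        (f := fun r τ => R (D (r, τ))) (hR.comp hD) _ _
    -- Both sides are continuous in `r`, so it suffices to treat `r ≠ 0`.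
    refine congrFun (hc1.ext_on (dense_compl_singleton 0) hc2 fun r hr => ?_)
    have hr : r ≠ 0 := hr
    symm
    refine intervalIntegral.integral_eq_sub_of_hasDerivAt (f := fun τ => Q (D (r, τ)))
      (fun τ _ => ?_) ((hcont r).intervalIntegrable _ _)
    simp only [hDr r _ hr]
    exact h r hr τ
  have hI : HasDerivAt (fun s => ∫ τ in (0 : ℝ)..s, R (D (0, τ))) (R (D (0, t))) t :=
    intervalIntegral.integral_hasDerivAt_right ((hcont 0).intervalIntegrable _ _)
      ((hcont 0).stronglyMeasurableAtFilter _ _) (hcont 0).continuousAt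
  have h1 := hI.add_const (Q (D (0, 0)))
  rw [hD0 t] at h1
  refine h1.congr_of_eventuallyEq (Eventually.of_forall fun s => ?_)
  simp only [← hint s 0, sub_add_cancel, ← hD0 s]

/-- The energy identity for the time derivative of a solution of `ε u'' + u' + 𝒜 u = n`. Since `u'` has
values in `H` only, the identity is proved for the difference quotients of `u`, whose values lie in
`V`, and carried over to the limit. -/
lemma hasDerivAt_derivative_energy {i : V →L[ℝ] H} {j : H →L[ℝ] StrongDual ℝ V}
    (hj : ∀ h ζ, j h ζ = ⟪h, i ζ⟫_ℝ) {ε : ℝ} (hε : 0 < ε) [CompleteSpace H] {u : ℝ → V}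
    {v n : ℝ → H} {w g : ℝ → StrongDual ℝ V} (huc : Continuous u) (hvc : Continuous v)
    (hnc : Continuous n) (hgc : Continuous g)
    (hw : ∀ t, w t = ε⁻¹ • (j (n t) - j (v t) - innerSL ℝ (u t)))
    (hu : ∀ t, HasDerivAt (fun s => i (u s)) (v t) t)
    (hv : ∀ t, HasDerivAt (fun s => j (v s)) (w t) t)
    (hn : ∀ t, HasDerivAt (fun s => j (n s)) (g t) t) (t : ℝ) :
    HasDerivAt (fun s => 1 / 2 * ⟪v s, v s⟫_ℝ
        + 1 / 2 * ε * ⟪rieszInv V (w s), rieszInv V (w s)⟫_ℝ)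
      (-⟪rieszInv V (w t), rieszInv V (w t)⟫_ℝ + ⟪rieszInv V (g t), rieszInv V (w t)⟫_ℝ) t := by
  have hwc : Continuous w := by
    rw [funext hw]
    fun_prop
  refine hasDerivAt_of_differenceQuotient
    (y := fun s => (i (u s), j (v s), j (n s))) (y' := fun s => (v s, w s, g s))
    (Q := fun p => 1 / 2 * ⟪p.1, p.1⟫_ℝ + 1 / 2 * ε * ⟪rieszInv V p.2.1, rieszInv V p.2.1⟫_ℝ)
    (R := fun p => -⟪rieszInv V p.2.1, rieszInv V p.2.1⟫_ℝ
      + ⟪rieszInv V p.2.2, rieszInv V p.2.1⟫_ℝ)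
    (fun s => (hu s).prodMk ((hv s).prodMk (hn s))) (by fun_prop) (by fun_prop) (by fun_prop)
    (fun r hr s => ?_) t
  have hu' : HasDerivAt (fun x => r⁻¹ • (i (u (x + r)) - i (u x))) (r⁻¹ • (v (s + r) - v s)) s :=
    (((hu (s + r)).comp_add_const s r).sub (hu s)).const_smul r⁻¹
  have hv' : HasDerivAt (fun x => r⁻¹ • (j (v (x + r)) - j (v x))) (r⁻¹ • (w (s + r) - w s)) s :=
    (((hv (s + r)).comp_add_const s r).sub (hv s)).const_smul r⁻¹
  have key := hasDerivAt_energy hj hε (η := fun s => r⁻¹ • (u (s + r) - u s))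
    (ν := fun s => r⁻¹ • (v (s + r) - v s)) (t := s) (Φ := r⁻¹ • (j (n (s + r)) - j (n s)))
    (by simp only [map_smul, map_sub]; exact hu') (by
      simp only [map_smul, map_sub]
      refine hv'.congr_deriv ?_
      simp only [hw, smul_sub, smul_comm r⁻¹ ε⁻¹]
      abel)
  simp only [map_smul, map_sub] at key
  simp only [Prod.mk_sub_mk, Prod.smul_mk, map_smul, map_sub]
  exact key

end Energy

lemma hasDerivAt_prodMk_iff {Y Z : Type*} [NormedAddCommGroup Y] [NormedSpace ℝ Y]
    [NormedAddCommGroup Z] [NormedSpace ℝ Z] {y : ℝ → Y} {z : ℝ → Z} {y' : Y} {z' : Z} {t : ℝ} :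
    HasDerivAt (fun s => (y s, z s)) (y', z') t ↔ HasDerivAt y y' t ∧ HasDerivAt z z' t :=
  ⟨fun h => ⟨(ContinuousLinearMap.fst ℝ Y Z).hasFDerivAt.comp_hasDerivAt t h,
    (ContinuousLinearMap.snd ℝ Y Z).hasFDerivAt.comp_hasDerivAt t h⟩, fun h => h.1.prodMk h.2⟩

/-! ### Solutions of the wave equation -/

/-- A mild solution of the wave equation satisfies `u' = v` in `H_0` and
`ε v' = n - v - ⟨u, ·⟩_{H_1}` in `H_{-1}`. -/
lemma hasDerivAt_solution {P : Coefficients Ω} {ε : ℝ} {T : ℝ → (H1 P × L2 Ω) →L[ℝ] (H1 P × L2 Ω)}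
    (hT : IsWaveSemigroup P ε T) {z : ℝ → H1 P × L2 Ω} {n : ℝ → L2 Ω} (hz : Continuous z)
    (hn : Continuous n) (h : ∀ t₀ t : ℝ, t₀ ≤ t →
      z t = T (t - t₀) (z t₀) + ∫ s in t₀..t, T (t - s) (0, ε⁻¹ • n s)) (t : ℝ) :
    HasDerivAt (fun s => (H1.toL2 (z s).1, Hneg1.ofL2 P (z s).2))
      ((z t).2, ε⁻¹ • (Hneg1.ofL2 P (n t) - Hneg1.ofL2 P (z t).2 - innerSL ℝ (z t).1)) t := by
  have hF : Continuous fun t => ((0, ε⁻¹ • n t) : H1 P × L2 Ω) :=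
    continuous_const.prodMk (show Continuous fun t => ε⁻¹ • n t from hn.const_smul ε⁻¹)
  have hG : ∀ x y : H1 P × L2 Ω, Tendsto (fun r : ℝ => r⁻¹ • (T r x - x)) (𝓝[>] 0) (𝓝 y) →
      stateInclusion P y = waveExtension P ε x := by
    intro x y hxy
    have h2 := ((hT.generator x (-y)).2 (by rwa [neg_neg])).stateInclusion_eq
    rwa [map_neg, neg_inj] at h2
  have h1 : HasDerivAt (fun s => stateInclusion P (z s))
      (waveExtension P ε (z t) + stateInclusion P (0, ε⁻¹ • n t)) t :=
    hT.toIsC0Semigroup.hasDerivAt_mild (Y := L2 Ω × Hneg1 P) hG hz hF h t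
  have e : waveExtension P ε (z t) + stateInclusion P (0, ε⁻¹ • n t)
      = ((z t).2,
        ε⁻¹ • (Hneg1.ofL2 P (n t) - Hneg1.ofL2 P (z t).2 - innerSL ℝ (z t).1)) := by
    rw [stateInclusion_apply, waveExtension_apply, Prod.mk_add_mk, map_zero, add_zero, map_smul,
      sub_sub, smul_sub, neg_add_eq_sub]
  rw [e] at h1
  exact h1

end DampedWave

theorem proposition3p5 (Ω : Opens E3) (P : Coefficients Ω) (f : E3 → ℝ → ℝ)
    (hf : IsNonlinearity Ω f) (ε : ℝ) (hε : 0 < ε)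
    (z : ℝ → H1 P × L2 Ω) (hz : IsFullSolution P f ε z) :
    ∃ w g : ℝ → Hneg1 P,
      (∀ t : ℝ, HasDerivAt (fun s => (H1.toL2 (z s).1, Hneg1.ofL2 P (z s).2)) ((z t).2, w t) t) ∧
      (∀ (t : ℝ) (ζ : H1 P),
        Integrable (fun x => deriv (f x) (H1.toL2 (z t).1 x) * (z t).2 x * H1.toL2 ζ x) (leb Ω) ∧
        g t ζ = ∫ x in (Ω : Set E3),
          deriv (f x) (H1.toL2 (z t).1 x) * (z t).2 x * H1.toL2 ζ x) ∧
      ∀ t : ℝ, HasDerivAt (fun s => V P ε (z s).2 (w s))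
        (-Hneg1.sp P (w t) (w t) + Hneg1.sp P (g t) (w t)) t := by
  obtain ⟨hzc, T, hT, hmild⟩ := hz
  choose A hA using fun u : H1 P => hf.exists_derivOperator u
  have hAc := hf.continuous_derivOperator hA
  set n : ℝ → L2 Ω := fun t => nemitski f (H1.toL2 (z t).1) with hn
  have hnc : Continuous n := (hf.continuous_nemitski P).comp hzc.fst
  let w : ℝ → Hneg1 P := fun t =>
    ε⁻¹ • (Hneg1.ofL2 P (n t) - Hneg1.ofL2 P (z t).2 - innerSL ℝ (z t).1)
  let g : ℝ → Hneg1 P := fun t => (innerSL ℝ (z t).2).comp (A (z t).1)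
  have hd : ∀ t, HasDerivAt (fun s => (H1.toL2 (z s).1, Hneg1.ofL2 P (z s).2))
      ((z t).2, w t) t := hasDerivAt_solution hT hzc hnc hmild
  have hd' := fun t => (hasDerivAt_prodMk_iff (Y := L2 Ω) (Z := Hneg1 P)
    (y := fun s => H1.toL2 (z s).1) (z := fun s => Hneg1.ofL2 P (z s).2) (y' := (z t).2)
    (z' := w t) (t := t)).1 (hd t)
  have hu := fun t => (hd' t).1
  have hv := fun t => (hd' t).2
  have hg : ∀ t, HasDerivAt (fun s => Hneg1.ofL2 P (n s)) (g t) t := fun t =>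
    hf.hasDerivAt_nemitski hA hzc.fst (hu t)
  have hgc : Continuous g := continuous_innerSL_comp hzc.snd (hAc.comp hzc.fst)
  refine ⟨w, g, hd, fun t ζ => ⟨?_, ?_⟩, fun t => ?_⟩
  · have h1 : MemLp (fun x => deriv (f x) (H1.toL2 (z t).1 x) * H1.toL2 ζ x) 2 (leb Ω) :=
      (memLp_congr_ae (hA (z t).1 ζ)).1 (Lp.memLp _)
    refine (h1.integrable_mul (Lp.memLp (z t).2)).congr (Eventually.of_forall fun x => ?_)
    simp only [Pi.mul_apply]
    ring
  · change ⟪(z t).2, A (z t).1 ζ⟫_ℝ = _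
    rw [L2.inner_def]
    refine integral_congr_ae ?_
    filter_upwards [hA (z t).1 ζ] with x hx
    simp only [hx, RCLike.inner_apply, conj_trivial]
    ring
  · exact hasDerivAt_derivative_energy (V := H1 P) (H := L2 Ω) (i := H1.toL2) (j := Hneg1.ofL2 P)
      (u := fun s => (z s).1) (v := fun s => (z s).2) (n := n) (w := w) (g := g) Hneg1.ofL2_apply hε
      hzc.fst hzc.snd hnc hgc (fun _ => rfl) hu hv hg t
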